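/- Let $\mu=(\mu_1,\dots,\mu_p)$ have independent real coordinates with arbitrary laws $P_1,\dots,P_p$, let $\mathbb P_\mu=P_1\otimes\dots\otimes P_p$, let $f:\mathbb R^p\to\mathbb R$ be measurable, and let $Y=f(\mu)$ satisfy $\mathbb E(Y^4)<\infty$ and $\operatorname{Var}(Y)>0$. Let $f=\sum_{\mathfrak u\subseteq\{1,\dots,p\}}f_{\mathfrak u}$ be the functional ANOVA (Hoeffding) decomposition, $f_{\mathfrak u}(\mu_{\mathfrak u})=\sum_{\mathfrak v\subseteq\mathfrak u}(-1)^{|\mathfrak u|-|\mathfrak v|}\,\mathbb E(Y\mid\mu_{\mathfrak v})$, and put $$S_{\mathfrak u}=\frac{\operatorname{Var}(f_{\mathfrak u}(\mu_{\mathfrak u}))}{\operatorname{Var}(Y)},\qquad S^{\mathrm{closed}}_{\mathfrak u}=\sum_{\mathfrak v\subseteq\mathfrak u}S_{\mathfrak v},\qquad S^{\mathrm{tot}}_{\{i\}}=\sum_{\mathfrak v\ni i}S_{\mathfrak v}.$$ Let $Y_{\mathfrak u}=f(\mu_{\mathfrak u},\mu'_{\mathfrak u^c})$ with $\mu'$ an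 independent copy of $\mu$, and let $v_{\mathfrak u}\ge 0$ be defined by $$v_{\mathfrak u}^2=\frac{\operatorname{Var}\Big((Y-\mathbb EY)(Y_{\mathfrak u}-\mathbb EY)-\frac{S^{\mathrm{closed}}_{\mathfrak u}}2\big((Y-\mathbb EY)^2+(Y_{\mathfrak u}-\mathbb EY)^2\big)\Big)}{(\operatorname{Var}Y)^2}.$$ Let $\mu^{j,1},\mu^{j,2}$, $j\ge1$, be independent copies of $\mu$. Let $(\tilde f_n)_n$ be measurable functions $\mathbb R^p\to\mathbb R$ (metamodels depending on the Monte Carlo sample size $n$), and put $\tilde Y^{j,1}_{\mathfrak u}=\tilde f_n(\mu^{j,1})$, $\tilde Y^{j,2}_{\mathfrak u}=\tilde f_n(\mu^{j,1}_{\mathfrak u},\mu^{j,2}_{\mathfrak u^c})$, $$\tilde S^{\mathrm{closed}}_{\mathfrak u,n}=\frac{\frac1n\sum_{j=1}^n\tilde Y^{j,1}_{\mathfrak u}\tilde Y^{j,2}_{\mathfrak u}-\Big(\frac1n\sum_{j=1}^n\frac{\tilde Y^{j,1}_{\mathfrak u}+\tilde Y^{j,2}_{\mathfrak u}}2\Big)^2}{\frac1n\sum_{j=1}^n\frac{(\tilde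 Y^{j,1}_{\mathfrak u})^2+(\tilde Y^{j,2}_{\mathfrak u})^2}2-\Big(\frac1n\sum_{j=1}^n\frac{\tilde Y^{j,1}_{\mathfrak u}+\tilde Y^{j,2}_{\mathfrak u}}2\Big)^2},\qquad \tilde S^{\mathrm{tot}}_{\{i\},n}=1-\tilde S^{\mathrm{closed}}_{\{i\}^c,n}.$$ Assume that there is $c\in\mathbb R$ with $\tilde f_n-f\to c$ in $L^2(\mathbb P_\mu)$ and that $n\operatorname{Var}(\tilde f_n(\mu)-f(\mu))\to0$. Let $\alpha\in(0,1)$ and let $z_{1-\alpha/2}$ be the $(1-\frac\alpha2)$-quantile of $\mathcal N(0,1)$. Then: (i) for every $\mathfrak u\subseteq\{1,\dots,p\}$ with $v_{\mathfrak u}\ne0$ and every estimator $\hat v_{\mathfrak u}=\hat v_{\mathfrak u,n}$ that converges in probability to $v_{\mathfrak u}$, $$\lim_{n\to\infty}\mathbb P\Big(S^{\mathrm{closed}}_{\mathfrak u}\in\Big[\tilde S^{\mathrm{closed}}_{\mathfrak u,n}-z_{1-\frac\alpha2}\tfrac{\hat v_{\mathfrak u}}{\sqrt n},\ \tilde S^{\mathrm{closed}}_{\mathfrak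 u,n}+z_{1-\frac\alpha2}\tfrac{\hat v_{\mathfrak u}}{\sqrt n}\Big]\Big)=1-\alpha;$$ (ii) for every $i\in\{1,\dots,p\}$, writing $\sim i=\{1,\dots,p\}\setminus\{i\}$, if $v_{\sim i}\ne0$ then for every estimator $\hat v_{\sim i}=\hat v_{\sim i,n}$ that converges in probability to $v_{\sim i}$, $$\lim_{n\to\infty}\mathbb P\Big(S^{\mathrm{tot}}_{\{i\}}\in\Big[\tilde S^{\mathrm{tot}}_{\{i\},n}-z_{1-\frac\alpha2}\tfrac{\hat v_{\sim i}}{\sqrt n},\ \tilde S^{\mathrm{tot}}_{\{i\},n}+z_{1-\frac\alpha2}\tfrac{\hat v_{\sim i}}{\sqrt n}\Big]\Big)=1-\alpha.$$ -/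

import Mathlib

open MeasureTheory ProbabilityTheory Filter Topology

namespace Sobol

noncomputable section

/-- The conditional expectation `E(f(μ) | μ_u = x_u)` when `μ` has independent coordinates
`μ_i ∼ P i`: the coordinates in `u` are frozen at `x`, the others are integrated out. -/
def condMean {p : ℕ} (P : Fin p → Measure ℝ) (f : (Fin p → ℝ) → ℝ) (u : Finset (Fin p))
    (x : Fin p → ℝ) : ℝ :=
  ∫ y, f (u.piecewise x y) ∂(Measure.pi P)

/-- The component `f_u` of the functional ANOVA (Hoeffding) decomposition
`f = ∑ u, f_u`, given by Möbius inversion of `E(f(μ) | μ_u) = ∑ v ⊆ u, f_v(μ_v)`. -/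
def anovaComponent {p : ℕ} (P : Fin p → Measure ℝ) (f : (Fin p → ℝ) → ℝ) (u : Finset (Fin p))
    (x : Fin p → ℝ) : ℝ :=
  ∑ v ∈ u.powerset, (-1 : ℝ) ^ (u.card - v.card) * condMean P f v x

/-- The Sobol' index `S_u = Var(f_u(μ_u)) / Var(f(μ))`. -/
def index {p : ℕ} (P : Fin p → Measure ℝ) (f : (Fin p → ℝ) → ℝ) (u : Finset (Fin p)) : ℝ :=
  variance (anovaComponent P f u) (Measure.pi P) / variance f (Measure.pi P)

/-- The closed Sobol' index: the sum of `S_v` over all `v ⊆ u`. -/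
def closedIndex {p : ℕ} (P : Fin p → Measure ℝ) (f : (Fin p → ℝ) → ℝ)
    (u : Finset (Fin p)) : ℝ :=
  ∑ v ∈ u.powerset, index P f v

/-- The total Sobol' index: the sum of `S_v` over all `v` containing `i`. -/
def totalIndex {p : ℕ} (P : Fin p → Measure ℝ) (f : (Fin p → ℝ) → ℝ) (i : Fin p) : ℝ :=
  ∑ v : Finset (Fin p) with i ∈ v, index P f v

/-- The asymptotic variance `v_u²`. On the product space, `z.1` is `μ` and `z.2` is an independent
copy, so `f z.1` is `Y` and `f (u.piecewise z.1 z.2)` is `Y_u`, which shares with `Y` exactly the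
inputs indexed by `u`. -/
def asympVar {p : ℕ} (P : Fin p → Measure ℝ) (f : (Fin p → ℝ) → ℝ) (u : Finset (Fin p)) : ℝ :=
  variance (fun z : (Fin p → ℝ) × (Fin p → ℝ) =>
      (f z.1 - ∫ x, f x ∂(Measure.pi P)) *
        (f (u.piecewise z.1 z.2) - ∫ x, f x ∂(Measure.pi P))
      - closedIndex P f u / 2 *
        ((f z.1 - ∫ x, f x ∂(Measure.pi P)) ^ 2 +
          (f (u.piecewise z.1 z.2) - ∫ x, f x ∂(Measure.pi P)) ^ 2))
    ((Measure.pi P).prod (Measure.pi P)) / (variance f (Measure.pi P)) ^ 2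

/-- The asymptotic standard deviation `v_u ≥ 0`. -/
def asympStd {p : ℕ} (P : Fin p → Measure ℝ) (f : (Fin p → ℝ) → ℝ) (u : Finset (Fin p)) : ℝ :=
  Real.sqrt (asympVar P f u)

/-- The pick-freeze ratio computed from the first `n` output pairs `(y₁ j, y₂ j)`. -/
def pickFreeze (n : ℕ) (y₁ y₂ : ℕ → ℝ) : ℝ :=
  ((1 / (n : ℝ)) * ∑ j ∈ Finset.range n, y₁ j * y₂ j
      - ((1 / (n : ℝ)) * ∑ j ∈ Finset.range n, (y₁ j + y₂ j) / 2) ^ 2) /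
    ((1 / (n : ℝ)) * ∑ j ∈ Finset.range n, (y₁ j ^ 2 + y₂ j ^ 2) / 2
      - ((1 / (n : ℝ)) * ∑ j ∈ Finset.range n, (y₁ j + y₂ j) / 2) ^ 2)

/-- The Monte Carlo estimator of the closed index of order `u` obtained by running the model `g` on
the first `n` points of the two input samples `x₁`, `x₂`. -/
def closedEstimator {p : ℕ} (g : (Fin p → ℝ) → ℝ) (u : Finset (Fin p)) (n : ℕ)
    (x₁ x₂ : ℕ → Fin p → ℝ) : ℝ :=
  pickFreeze n (fun j => g (x₁ j)) (fun j => g (u.piecewise (x₁ j) (x₂ j)))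

/-- The Monte Carlo estimator of the total index of input `i`. -/
def totalEstimator {p : ℕ} (g : (Fin p → ℝ) → ℝ) (i : Fin p) (n : ℕ)
    (x₁ x₂ : ℕ → Fin p → ℝ) : ℝ :=
  1 - closedEstimator g ({i}ᶜ) n x₁ x₂

/-- The quantile of order `q` of a probability distribution on `ℝ`. -/
def quantile (ν : Measure ℝ) (q : ℝ) : ℝ :=
  sInf {x : ℝ | q ≤ cdf ν x}

/-- The random intervals `[a n, b n]` form an asymptotic confidence interval for `θ` of the
given level: their coverage probability converges to it. -/
def IsAsymptoticCI {Ω : Type*} [MeasurableSpace Ω] (Pr : Measure Ω) (θ : ℝ) (a b : ℕ → Ω → ℝ)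
    (level : ℝ) : Prop :=
  Tendsto (fun n => Pr.real {ω | θ ∈ Set.Icc (a n ω) (b n ω)}) atTop (𝓝 level)

/-- `w` is a (weakly) consistent estimator of `θ`. -/
def IsConsistent {Ω : Type*} [MeasurableSpace Ω] (Pr : Measure Ω) (w : ℕ → Ω → ℝ)
    (θ : ℝ) : Prop :=
  (∀ n, AEMeasurable (w n) Pr) ∧ TendstoInMeasure Pr w atTop (fun _ => θ)

end

end Sobol

/-! Write θ for the closed index, σ for `Var Y`, and N / D for the pick-freeze ratio. Three facts
carry the proof.

Pick-freeze identity (`closedIndex_eq`, `integral_centred_mul_piecewise`): Cov(Y, Y_u) = θσ. By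
Fubini, the mean of the product of two conditional means along u and v depends only on u ∩ v. The
ANOVA components are therefore orthogonal, and Möbius inversion collapses the sum of their variances
to this covariance.

Reduction to a small centred perturbation: the ratio does not change when a constant is added to all
outputs (`pickFreeze_add_const`). So Y may be centred and the metamodel replaced by Y plus a centred
error r_n with n E(r_n²) → 0. Then N - θD is the empirical mean of k = Y Y_u - θ(Y² + Y_u²)/2 up to
a remainder. The remainder is quadratic in the sample mean or carries a factor r_n; by
Cauchy–Schwarz its L¹ norm is o(n^(-1/2)).

Limit theorem (`tendsto_pickFreeze_coverage`): k has mean 0 and variance (v_u σ)², so √n (N - θD)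
converges in law to a centred Gaussian with that variance, while D → σ and the estimator of v_u is
consistent. Where D > 0, covering θ means |√n (N - θD)| ≤ z · (estimator) · D. Slutsky's lemma gives
the probability of this event, with no delta method. The event D ≤ 0 has vanishing probability.

The total index reduces to the closed one through `totalIndex_eq`. -/

namespace Sobol

noncomputable section

/-! ### Resampling maps and second moments of conditional means -/

section Anova

variable {p : ℕ} (P : Fin p → Measure ℝ) [∀ i, IsProbabilityMeasure (P i)]

theorem measurable_piecewise_prod (u : Finset (Fin p)) :
    Measurable fun z : (Fin p → ℝ) × (Fin p → ℝ) => u.piecewise z.1 z.2 := by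
  refine measurable_pi_lambda _ fun i => ?_
  by_cases h : i ∈ u
  · simp only [h, Finset.piecewise_eq_of_mem]; fun_prop
  · simp only [h, not_false_eq_true, Finset.piecewise_eq_of_notMem]; fun_prop

/-- Exchanging the coordinates outside `u` between two independent copies preserves their law. -/
theorem measurePreserving_piecewise_swap (u : Finset (Fin p)) :
    MeasurePreserving
      (fun z : (Fin p → ℝ) × (Fin p → ℝ) => (u.piecewise z.1 z.2, u.piecewise z.2 z.1))
      ((Measure.pi P).prod (Measure.pi P)) ((Measure.pi P).prod (Measure.pi P)) := by
  have e := measurePreserving_arrowProdEquivProdArrow ℝ ℝ (Fin p) P P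
  -- In terms of the independent pairs formed by the two copies of each coordinate, the map swaps
  -- the pairs outside u, and P i ⊗ P i is symmetric.
  have h : MeasurePreserving
      (fun (w : Fin p → ℝ × ℝ) i => (if i ∈ u then id else Prod.swap) (w i))
      (Measure.pi fun i => (P i).prod (P i)) (Measure.pi fun i => (P i).prod (P i)) := by
    refine measurePreserving_pi (f := fun i => if i ∈ u then id else Prod.swap) _ _ fun i => ?_
    split_ifs
    · exact MeasurePreserving.id _
    · exact Measure.measurePreserving_swap
  have := (e.comp h).comp (e.symm _)
  convert this using 1
  ext z i
  all_goals
    by_cases hi : i ∈ u <;>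
      simp [hi, MeasurableEquiv.arrowProdEquivProdArrow, Equiv.arrowProdEquivProdArrow]

theorem measurePreserving_piecewise (u : Finset (Fin p)) :
    MeasurePreserving (fun z : (Fin p → ℝ) × (Fin p → ℝ) => u.piecewise z.1 z.2)
      ((Measure.pi P).prod (Measure.pi P)) (Measure.pi P) :=
  measurePreserving_fst.comp (measurePreserving_piecewise_swap P u)

/-- The noncentred pick-freeze covariance `E(Y Y_u)`. -/
def crossMoment (f : (Fin p → ℝ) → ℝ) (u : Finset (Fin p)) : ℝ :=
  ∫ z : (Fin p → ℝ) × (Fin p → ℝ), f z.1 * f (u.piecewise z.1 z.2)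
    ∂((Measure.pi P).prod (Measure.pi P))

theorem measurePreserving_piecewise_left (u : Finset (Fin p)) :
    MeasurePreserving
      (fun t : (Fin p → ℝ) × (Fin p → ℝ) × (Fin p → ℝ) => u.piecewise t.1 t.2.1)
      ((Measure.pi P).prod ((Measure.pi P).prod (Measure.pi P))) (Measure.pi P) :=
  (measurePreserving_piecewise P u).comp
    ((MeasurePreserving.id (Measure.pi P)).prod
      (measurePreserving_fst (μ := Measure.pi P) (ν := Measure.pi P)))

theorem measurePreserving_piecewise_right (u : Finset (Fin p)) :
    MeasurePreserving
      (fun t : (Fin p → ℝ) × (Fin p → ℝ) × (Fin p → ℝ) => u.piecewise t.1 t.2.2)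
      ((Measure.pi P).prod ((Measure.pi P).prod (Measure.pi P))) (Measure.pi P) :=
  (measurePreserving_piecewise P u).comp
    ((MeasurePreserving.id (Measure.pi P)).prod
      (measurePreserving_snd (μ := Measure.pi P) (ν := Measure.pi P)))

/-- The pair of two pick-frozen copies that share the inputs in `u` and `v` respectively with a
common sample has the law of a sample and its pick-frozen copy along `u ∩ v`. -/
theorem measurePreserving_piecewise_pair (u v : Finset (Fin p)) :
    MeasurePreserving
      (fun t : (Fin p → ℝ) × (Fin p → ℝ) × (Fin p → ℝ) =>
        (u.piecewise t.1 t.2.1, v.piecewise (u.piecewise t.2.1 t.1) t.2.2))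
      ((Measure.pi P).prod ((Measure.pi P).prod (Measure.pi P)))
      ((Measure.pi P).prod (Measure.pi P)) := by
  have h1 := (measurePreserving_prodAssoc (Measure.pi P) (Measure.pi P) (Measure.pi P)).symm
  have h2 := (measurePreserving_piecewise_swap P u).prod (MeasurePreserving.id (Measure.pi P))
  have h3 := measurePreserving_prodAssoc (Measure.pi P) (Measure.pi P) (Measure.pi P)
  have h4 := (MeasurePreserving.id (Measure.pi P)).prod (measurePreserving_piecewise P v)
  exact ((h4.comp h3).comp h2).comp h1

variable {f : (Fin p → ℝ) → ℝ}

theorem integrable_piecewise_mul (hf : MemLp f 2 (Measure.pi P)) (u v : Finset (Fin p)) :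
    Integrable (fun t : (Fin p → ℝ) × (Fin p → ℝ) × (Fin p → ℝ) =>
        f (u.piecewise t.1 t.2.1) * f (v.piecewise t.1 t.2.2))
      ((Measure.pi P).prod ((Measure.pi P).prod (Measure.pi P))) :=
  (hf.comp_measurePreserving (measurePreserving_piecewise_left P u)).integrable_mul
    (hf.comp_measurePreserving (measurePreserving_piecewise_right P v))

theorem condMean_mul_condMean (f : (Fin p → ℝ) → ℝ) (u v : Finset (Fin p)) (x : Fin p → ℝ) :
    condMean P f u x * condMean P f v x =
      ∫ w : (Fin p → ℝ) × (Fin p → ℝ), f (u.piecewise x w.1) * f (v.piecewise x w.2)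
        ∂((Measure.pi P).prod (Measure.pi P)) :=
  (integral_prod_mul (fun y => f (u.piecewise x y)) fun y => f (v.piecewise x y)).symm

theorem integrable_condMean_mul (hf : MemLp f 2 (Measure.pi P)) (u v : Finset (Fin p)) :
    Integrable (fun x => condMean P f u x * condMean P f v x) (Measure.pi P) := by
  simp_rw [condMean_mul_condMean]
  exact (integrable_piecewise_mul P hf u v).integral_prod_left

/-- Each conditional mean averages over its own independent resample. The two resampled points share
exactly the inputs in u ∩ v, so they form a pick-freeze pair along u ∩ v. -/
theorem integral_condMean_mul (hfm : Measurable f) (hf : MemLp f 2 (Measure.pi P))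
    (u v : Finset (Fin p)) :
    ∫ x, condMean P f u x * condMean P f v x ∂(Measure.pi P) = crossMoment P f (u ∩ v) := by
  simp_rw [condMean_mul_condMean]
  rw [← integral_prod _ (integrable_piecewise_mul P hf u v), crossMoment]
  conv_rhs => rw [← (measurePreserving_piecewise_pair P u v).map_eq]
  rw [integral_map]
  · refine integral_congr_ae (Eventually.of_forall fun t => ?_)
    refine congrArg (fun y => f (u.piecewise t.1 t.2.1) * f y) ?_
    ext i
    by_cases hu : i ∈ u <;> by_cases hv : i ∈ v <;> simp [hu, hv]
  · exact (measurePreserving_piecewise_pair P u v).measurable.aemeasurable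
  · exact ((hfm.comp measurable_fst).mul
      (hfm.comp (measurable_piecewise_prod _))).aestronglyMeasurable

theorem aestronglyMeasurable_condMean (hfm : Measurable f) (u : Finset (Fin p)) :
    AEStronglyMeasurable (condMean P f u) (Measure.pi P) :=
  (StronglyMeasurable.integral_prod_right (f := fun x y => f (u.piecewise x y))
    (hfm.comp (measurable_piecewise_prod u)).stronglyMeasurable).aestronglyMeasurable

theorem memLp_condMean (hfm : Measurable f) (hf : MemLp f 2 (Measure.pi P))
    (u : Finset (Fin p)) : MemLp (condMean P f u) 2 (Measure.pi P) := by
  refine (memLp_two_iff_integrable_sq (aestronglyMeasurable_condMean P hfm u)).2 ?_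
  simpa only [sq] using integrable_condMean_mul P hf u u

theorem integral_condMean (hf : Integrable f (Measure.pi P)) (u : Finset (Fin p)) :
    ∫ x, condMean P f u x ∂(Measure.pi P) = ∫ x, f x ∂(Measure.pi P) := by
  have hm := measurePreserving_piecewise P u
  have hi : Integrable (fun z : (Fin p → ℝ) × (Fin p → ℝ) => f (u.piecewise z.1 z.2))
      ((Measure.pi P).prod (Measure.pi P)) := hm.integrable_comp_of_integrable hf
  unfold condMean
  rw [← integral_prod _ hi]
  conv_rhs => rw [← hm.map_eq]
  rw [integral_map hm.measurable.aemeasurable]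
  rw [hm.map_eq]
  exact hf.aestronglyMeasurable

end Anova

/-! ### Möbius inversion on finite subsets -/

section Moebius

variable {ι : Type*} [DecidableEq ι]

/-- Pairing t with `insert a t` turns the alternating sum into one of differences in direction a. It
vanishes as soon as q ignores a, and it drives the induction for Möbius inversion. -/
theorem sum_powerset_insert_neg_one {a : ι} {s : Finset ι} (ha : a ∉ s) (q : Finset ι → ℝ) :
    ∑ t ∈ (insert a s).powerset, (-1 : ℝ) ^ ((insert a s).card - t.card) * q t =
      ∑ t ∈ s.powerset, (-1 : ℝ) ^ (s.card - t.card) * (q (insert a t) - q t) := by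
  rw [Finset.sum_powerset_insert ha, ← Finset.sum_add_distrib]
  refine Finset.sum_congr rfl fun t ht => ?_
  have hts := Finset.mem_powerset.1 ht
  have hat : a ∉ t := fun h => ha (hts h)
  have hc := Finset.card_le_card hts
  rw [Finset.card_insert_of_notMem ha, Finset.card_insert_of_notMem hat,
    show s.card + 1 - t.card = (s.card - t.card) + 1 by omega,
    show s.card + 1 - (t.card + 1) = s.card - t.card by omega]
  ring

/-- The alternating sum of `q (t ∩ w)` over the subsets `t` of `v` vanishes unless `v ⊆ w`. -/
theorem sum_powerset_neg_one_inter_eq_zero {v w : Finset ι} (h : ¬ v ⊆ w) (q : Finset ι → ℝ) :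
    ∑ t ∈ v.powerset, (-1 : ℝ) ^ (v.card - t.card) * q (t ∩ w) = 0 := by
  obtain ⟨a, hav, haw⟩ := Finset.not_subset.1 h
  rw [← Finset.insert_erase hav,
    sum_powerset_insert_neg_one (Finset.notMem_erase a v) fun t => q (t ∩ w)]
  refine Finset.sum_eq_zero fun t _ => ?_
  simp [Finset.insert_inter_of_notMem haw]

/-- Möbius inversion on the lattice of finite subsets. -/
theorem sum_powerset_moebius (q : Finset ι → ℝ) (u : Finset ι) :
    ∑ v ∈ u.powerset, ∑ t ∈ v.powerset, (-1 : ℝ) ^ (v.card - t.card) * q t = q u := by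
  induction u using Finset.induction_on generalizing q with
  | empty => simp
  | insert a s ha ih =>
    rw [Finset.sum_powerset_insert ha, ih]
    have : ∑ v ∈ s.powerset, ∑ t ∈ (insert a v).powerset,
        (-1 : ℝ) ^ ((insert a v).card - t.card) * q t = q (insert a s) - q s := by
      rw [← ih fun t => q (insert a t) - q t]
      refine Finset.sum_congr rfl fun v hv => ?_
      exact sum_powerset_insert_neg_one (fun h => ha (Finset.mem_powerset.1 hv h)) q
    rw [this]; ring

theorem sum_powerset_neg_one (v : Finset ι) :
    ∑ t ∈ v.powerset, (-1 : ℝ) ^ (v.card - t.card) = if v = ∅ then 1 else 0 := by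
  split_ifs with h
  · simp [h]
  · have := sum_powerset_neg_one_inter_eq_zero (v := v) (w := ∅)
      (by simpa [Finset.subset_empty] using h) fun _ => 1
    simpa using this

end Moebius

/-! ### Orthogonality of ANOVA components and the pick-freeze identity -/

section Anova

variable {p : ℕ} (P : Fin p → Measure ℝ) [∀ i, IsProbabilityMeasure (P i)]
  {f : (Fin p → ℝ) → ℝ}

theorem memLp_anovaComponent (hfm : Measurable f) (hf : MemLp f 2 (Measure.pi P))
    (u : Finset (Fin p)) : MemLp (anovaComponent P f u) 2 (Measure.pi P) :=
  memLp_finsetSum _ fun v _ => (memLp_condMean P hfm hf v).const_mul _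

theorem integral_anovaComponent (hfm : Measurable f) (hf : MemLp f 2 (Measure.pi P))
    (u : Finset (Fin p)) :
    ∫ x, anovaComponent P f u x ∂(Measure.pi P) =
      if u = ∅ then ∫ x, f x ∂(Measure.pi P) else 0 := by
  unfold anovaComponent
  rw [integral_finsetSum _ fun v _ =>
    ((memLp_condMean P hfm hf v).integrable one_le_two).const_mul _]
  simp_rw [integral_const_mul, integral_condMean P (hf.integrable one_le_two)]
  rw [← Finset.sum_mul, sum_powerset_neg_one]
  split_ifs <;> simp

theorem integral_anovaComponent_mul_condMean (hfm : Measurable f)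
    (hf : MemLp f 2 (Measure.pi P)) (v w : Finset (Fin p)) :
    ∫ x, anovaComponent P f v x * condMean P f w x ∂(Measure.pi P) =
      ∑ t ∈ v.powerset, (-1 : ℝ) ^ (v.card - t.card) * crossMoment P f (t ∩ w) := by
  simp_rw [anovaComponent, Finset.sum_mul, mul_assoc]
  rw [integral_finsetSum _ fun t _ => (integrable_condMean_mul P hf t w).const_mul _]
  simp_rw [integral_const_mul, integral_condMean_mul P hfm hf]

/-- A component is orthogonal to every conditional mean along a proper subset of v. Expanding only
one of the two factors therefore leaves the single term w = v. -/
theorem integral_anovaComponent_sq (hfm : Measurable f) (hf : MemLp f 2 (Measure.pi P))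
    (v : Finset (Fin p)) :
    ∫ x, anovaComponent P f v x ^ 2 ∂(Measure.pi P) =
      ∑ t ∈ v.powerset, (-1 : ℝ) ^ (v.card - t.card) * crossMoment P f t := by
  have h : ∀ x, anovaComponent P f v x ^ 2 = ∑ w ∈ v.powerset,
      (-1 : ℝ) ^ (v.card - w.card) * (anovaComponent P f v x * condMean P f w x) := fun x => by
    rw [sq]
    conv_lhs => arg 2; rw [anovaComponent]
    rw [Finset.mul_sum]
    exact Finset.sum_congr rfl fun w _ => by ring
  simp_rw [h]
  rw [integral_finsetSum]
  · simp_rw [integral_const_mul, integral_anovaComponent_mul_condMean P hfm hf]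
    rw [Finset.sum_eq_single_of_mem v (Finset.mem_powerset_self v)]
    · simp only [Nat.sub_self, pow_zero, one_mul]
      refine Finset.sum_congr rfl fun t ht => ?_
      rw [Finset.inter_eq_left.2 (Finset.mem_powerset.1 ht)]
    · intro w hw hne
      rw [sum_powerset_neg_one_inter_eq_zero, mul_zero]
      exact fun h => hne (Finset.Subset.antisymm (Finset.mem_powerset.1 hw) h)
  · exact fun w _ => ((memLp_anovaComponent P hfm hf v).integrable_mul
      (memLp_condMean P hfm hf w)).const_mul _

/-- The second moments of the components are the Möbius transform of `crossMoment`, so summing them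
inverts it. Only the empty component has a nonzero mean, which accounts for the subtracted square.
-/
theorem sum_variance_anovaComponent (hfm : Measurable f) (hf : MemLp f 2 (Measure.pi P))
    (u : Finset (Fin p)) :
    ∑ v ∈ u.powerset, variance (anovaComponent P f v) (Measure.pi P) =
      crossMoment P f u - (∫ x, f x ∂(Measure.pi P)) ^ 2 := by
  have h : ∀ v ∈ u.powerset, variance (anovaComponent P f v) (Measure.pi P) =
      (∑ t ∈ v.powerset, (-1 : ℝ) ^ (v.card - t.card) * crossMoment P f t) -
        if v = ∅ then (∫ x, f x ∂(Measure.pi P)) ^ 2 else 0 := fun v _ => by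
    rw [variance_eq_sub (memLp_anovaComponent P hfm hf v), integral_anovaComponent P hfm hf,
      ← integral_anovaComponent_sq P hfm hf]
    split_ifs <;> simp
  rw [Finset.sum_congr rfl h, Finset.sum_sub_distrib, sum_powerset_moebius]
  simp

theorem closedIndex_eq (hfm : Measurable f) (hf : MemLp f 2 (Measure.pi P))
    (u : Finset (Fin p)) :
    closedIndex P f u =
      (crossMoment P f u - (∫ x, f x ∂(Measure.pi P)) ^ 2) / variance f (Measure.pi P) := by
  rw [← sum_variance_anovaComponent P hfm hf, closedIndex, Finset.sum_div]
  rfl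

theorem closedIndex_univ (hfm : Measurable f) (hf : MemLp f 2 (Measure.pi P))
    (hvar : variance f (Measure.pi P) ≠ 0) : closedIndex P f Finset.univ = 1 := by
  rw [closedIndex_eq P hfm hf, div_eq_one_iff_eq hvar, variance_eq_sub hf, crossMoment]
  congr 1
  simp only [Finset.piecewise_univ]
  rw [integral_fun_fst (fun x => f x * f x)]
  simp [sq]

theorem totalIndex_eq (hfm : Measurable f) (hf : MemLp f 2 (Measure.pi P))
    (hvar : variance f (Measure.pi P) ≠ 0) (i : Fin p) :
    totalIndex P f i = 1 - closedIndex P f {i}ᶜ := by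
  rw [← closedIndex_univ P hfm hf hvar, totalIndex, closedIndex, closedIndex,
    Finset.powerset_univ, ← Finset.sum_filter_add_sum_filter_not Finset.univ (fun v => i ∈ v)]
  have : (Finset.univ.filter fun v : Finset (Fin p) => i ∉ v) = ({i}ᶜ : Finset _).powerset := by
    ext v
    simp [Finset.subset_compl_singleton]
  rw [this]; ring

end Anova

/-! ### Laws and independence of the sampled input pairs -/

section Sample

variable {Ω : Type*} [MeasurableSpace Ω] {Pr : Measure Ω}

/-- Grouping an independent family along the first index yields independent random vectors. -/
theorem iIndepFun_curry {ι κ E : Type*} [MeasurableSpace E] [IsProbabilityMeasure Pr]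
    {X : ι → κ → Ω → E} (hX : ∀ i k, Measurable (X i k))
    (h : iIndepFun (fun a : ι × κ => X a.1 a.2) Pr) :
    iIndepFun (fun i ω k => X i k ω) Pr := by
  have hp : ∀ i k, IsProbabilityMeasure (Pr.map (X i k)) :=
    fun i k => Measure.isProbabilityMeasure_map (hX i k).aemeasurable
  have hrow : ∀ i, iIndepFun (X i) Pr := fun i =>
    h.precomp (g := fun k => (i, k)) (Prod.mk_right_injective i)
  rw [iIndepFun_iff_map_fun_eq_infinitePi_map (by fun_prop)]
  have h1 := (iIndepFun_iff_map_fun_eq_infinitePi_map (by fun_prop)).1 h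
  -- Currying turns the product over ι × κ into an iterated product, whose inner factors are the
  -- joint laws of the rows.
  have h2 := congrArg (Measure.map (MeasurableEquiv.curry ι κ E)) h1
  rw [Measure.map_map (by fun_prop) (by fun_prop),
    Measure.infinitePi_map_curry (fun i k => Pr.map (X i k))] at h2
  refine h2.trans ?_
  congr 1 with i : 1
  exact ((iIndepFun_iff_map_fun_eq_infinitePi_map (hX i)).1 (hrow i)).symm

variable {p : ℕ} {P : Fin p → Measure ℝ} [IsProbabilityMeasure Pr] {X : Fin 2 → ℕ → Fin p → Ω → ℝ}

theorem iIndepFun_samplePair (hX : ∀ k j i, Measurable (X k j i))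
    (hindep : iIndepFun (fun a : Fin 2 × ℕ × Fin p => X a.1 a.2.1 a.2.2) Pr) :
    iIndepFun (fun j ω => ((fun i => X 0 j i ω : Fin p → ℝ), (fun i => X 1 j i ω : Fin p → ℝ)))
      Pr := by
  have h : iIndepFun (fun a : ℕ × (Fin 2 × Fin p) => X a.2.1 a.1 a.2.2) Pr :=
    hindep.precomp (g := fun a : ℕ × (Fin 2 × Fin p) => (a.2.1, a.1, a.2.2))
      fun a b hab => by simp only [Prod.mk.injEq] at hab; ext <;> simp [hab]
  have hc := iIndepFun_curry (X := fun j (a : Fin 2 × Fin p) => X a.1 j a.2)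
    (fun j a => hX _ _ _) h
  exact hc.comp (fun _ w => ((fun i => w (0, i) : Fin p → ℝ), (fun i => w (1, i) : Fin p → ℝ)))
    fun _ => by fun_prop

theorem hasLaw_samplePair (hX : ∀ k j i, Measurable (X k j i))
    (hlaw : ∀ k j i, Pr.map (X k j i) = P i)
    (hindep : iIndepFun (fun a : Fin 2 × ℕ × Fin p => X a.1 a.2.1 a.2.2) Pr) (j : ℕ) :
    HasLaw (fun ω => ((fun i => X 0 j i ω : Fin p → ℝ), (fun i => X 1 j i ω : Fin p → ℝ)))
      ((Measure.pi P).prod (Measure.pi P)) Pr := by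
  have hrow : iIndepFun (fun k ω i => X k j i ω) Pr :=
    iIndepFun_curry (X := fun k i => X k j i) (fun k i => hX k j i)
      (hindep.precomp (g := fun a : Fin 2 × Fin p => (a.1, j, a.2))
        fun a b hab => by simp only [Prod.mk.injEq] at hab; ext <;> simp [hab])
  have hl : ∀ k, HasLaw (fun ω i => X k j i ω) (Measure.pi P) Pr := fun k =>
    iIndepFun.hasLaw_pi (fun i => ⟨(hX k j i).aemeasurable, hlaw k j i⟩)
      (hindep.precomp (g := fun i : Fin p => (k, j, i))
        fun a b hab => by simpa using hab)
  exact (indepFun_iff_hasLaw_prodMk_prod (hl 0) (hl 1)).1 (hrow.indepFun (by decide))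

end Sample

/-! ### Two-sided coverage of the standard Gaussian quantile -/

section Quantile

theorem quantile_gaussian_coverage {α : ℝ} (hα : α ∈ Set.Ioo (0 : ℝ) 1) :
    0 < quantile (gaussianReal 0 1) (1 - α / 2) ∧
    (gaussianReal 0 1).real
      {x | |x| ≤ quantile (gaussianReal 0 1) (1 - α / 2)} = 1 - α := by
  obtain ⟨h0, h1⟩ := hα
  have hna : NullSingletonClass (gaussianReal 0 1) :=
    nullSingletonClass_gaussianReal one_ne_zero
  set F := cdf (gaussianReal 0 1)
  set q := 1 - α / 2 with hq
  set z := quantile (gaussianReal 0 1) q with hz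
  have hsymm : ∀ x, F (-x) = 1 - F x := fun x => by
    have h2 : (gaussianReal 0 1).real (Set.Iic (-x)) = (gaussianReal 0 1).real (Set.Ici x) := by
      have h3 := gaussianReal_map_neg (μ := 0) (v := 1)
      rw [neg_zero] at h3
      conv_lhs => rw [← h3]
      rw [map_measureReal_apply measurable_neg measurableSet_Iic]
      congr 1; ext y; simp
    rw [cdf_eq_real, cdf_eq_real, h2, ← measureReal_congr Ioi_ae_eq_Ici, ← Set.compl_Iic,
      probReal_compl_eq_one_sub measurableSet_Iic]
  have hcont : Continuous F := by
    rw [continuous_iff_continuousAt]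
    intro x
    refine (monotone_cdf _).continuousAt_iff_leftLim_eq_rightLim.2 ?_
    rw [F.rightLim_eq]
    have h2 := F.measure_singleton x
    rw [measure_cdf, measure_singleton] at h2
    have h3 := ENNReal.ofReal_eq_zero.1 h2.symm
    have h4 := (monotone_cdf (gaussianReal 0 1)).leftLim_le le_rfl (x := x)
    exact le_antisymm h4 (by linarith)
  have hne : {x : ℝ | q ≤ F x}.Nonempty := by
    obtain ⟨x, hx⟩ := ((tendsto_cdf_atTop (gaussianReal 0 1)).eventually
      (lt_mem_nhds (show q < 1 by linarith))).exists
    exact ⟨x, hx.le⟩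
  have hbdd : BddBelow {x : ℝ | q ≤ F x} := by
    -- For x < 0, symmetry gives F x ≤ 1 - F x, so F x ≤ 1/2 < q.
    refine ⟨0, fun x hx => ?_⟩
    by_contra! h
    have h2 : F x ≤ F (-x) := monotone_cdf _ (by linarith)
    rw [hsymm] at h2
    have : q ≤ F x := hx
    linarith
  have hmem : q ≤ F z := (isClosed_le continuous_const hcont).csInf_mem hne hbdd
  -- Points to the left of the infimum satisfy F x < q; continuity passes this to z.
  have hle : F z ≤ q := by
    refine le_of_tendsto (hcont.continuousAt.continuousWithinAt (s := Set.Iio z)) ?_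
    filter_upwards [self_mem_nhdsWithin] with x hx
    by_contra! h
    exact absurd (csInf_le hbdd h.le) (not_le.2 hx)
  have hFz : F z = q := le_antisymm hle hmem
  have hpos : 0 < z := by
    by_contra! h
    have h2 : F z ≤ F (-z) := monotone_cdf _ (by linarith)
    rw [hsymm] at h2
    linarith
  refine ⟨hpos, ?_⟩
  have hset : {x : ℝ | |x| ≤ z} = Set.Icc (-z) z := by ext x; simp [abs_le]
  rw [hset, ← measureReal_congr Ioc_ae_eq_Icc, ← Set.Iic_sdiff_Iic,
    measureReal_sdiff (Set.Iic_subset_Iic.2 (by linarith)) measurableSet_Iic,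
    ← cdf_eq_real, ← cdf_eq_real, hsymm, hFz]
  ring

end Quantile

/-! ### Deterministic perturbation bounds for the pick-freeze ratio -/

section Average

/-- The empirical mean of the first `n` terms of a sequence. -/
def avg (n : ℕ) (x : ℕ → ℝ) : ℝ := (1 / (n : ℝ)) * ∑ j ∈ Finset.range n, x j

theorem avg_add (n : ℕ) (x y : ℕ → ℝ) : avg n (fun j => x j + y j) = avg n x + avg n y := by
  simp only [avg, Finset.sum_add_distrib, mul_add]

theorem avg_sub (n : ℕ) (x y : ℕ → ℝ) : avg n (fun j => x j - y j) = avg n x - avg n y := by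
  simp only [avg, Finset.sum_sub_distrib, mul_sub]

theorem avg_const_mul (n : ℕ) (c : ℝ) (x : ℕ → ℝ) :
    avg n (fun j => c * x j) = c * avg n x := by
  simp only [avg, ← Finset.mul_sum]; ring

theorem avg_const {n : ℕ} (hn : n ≠ 0) (c : ℝ) : avg n (fun _ => c) = c := by
  simp [avg, hn]

theorem avg_mono (n : ℕ) {x y : ℕ → ℝ} (h : ∀ j, x j ≤ y j) : avg n x ≤ avg n y :=
  mul_le_mul_of_nonneg_left (Finset.sum_le_sum fun j _ => h j) (by positivity)

theorem abs_avg_le (n : ℕ) (x : ℕ → ℝ) : |avg n x| ≤ avg n fun j => |x j| := by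
  rw [avg, abs_mul, abs_of_nonneg (by positivity : (0 : ℝ) ≤ 1 / n)]
  exact mul_le_mul_of_nonneg_left (Finset.abs_sum_le_sum_abs _ _) (by positivity)

theorem avg_sq_le (n : ℕ) (x : ℕ → ℝ) : avg n x ^ 2 ≤ avg n fun j => x j ^ 2 := by
  rcases Nat.eq_zero_or_pos n with rfl | hn
  · simp [avg]
  have h := sq_sum_le_card_mul_sum_sq (s := Finset.range n) (f := x)
  rw [Finset.card_range] at h
  have hn' : (0 : ℝ) < n := by exact_mod_cast hn
  calc avg n x ^ 2 = (1 / (n : ℝ)) ^ 2 * (∑ j ∈ Finset.range n, x j) ^ 2 := by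
        rw [avg, mul_pow]
    _ ≤ (1 / (n : ℝ)) ^ 2 * (n * ∑ j ∈ Finset.range n, x j ^ 2) := by gcongr
    _ = _ := by rw [avg]; field_simp

/-- The numerator of the pick-freeze ratio. -/
def pickFreezeNum (n : ℕ) (x y : ℕ → ℝ) : ℝ :=
  avg n (fun j => x j * y j) - avg n (fun j => (x j + y j) / 2) ^ 2

/-- The denominator of the pick-freeze ratio. -/
def pickFreezeDen (n : ℕ) (x y : ℕ → ℝ) : ℝ :=
  avg n (fun j => (x j ^ 2 + y j ^ 2) / 2) - avg n (fun j => (x j + y j) / 2) ^ 2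

theorem pickFreeze_eq_div (n : ℕ) (x y : ℕ → ℝ) :
    pickFreeze n x y = pickFreezeNum n x y / pickFreezeDen n x y := rfl

/-- Numerator and denominator are an empirical covariance and variance about the pooled mean. This
invariance absorbs both the mean of Y and the bias of the metamodel. -/
theorem pickFreeze_add_const {n : ℕ} (hn : n ≠ 0) (x y : ℕ → ℝ) (c : ℝ) :
    pickFreeze n (fun j => x j + c) (fun j => y j + c) = pickFreeze n x y := by
  have h1 : avg n (fun j => (x j + c + (y j + c)) / 2) = avg n (fun j => (x j + y j) / 2) + c := by
    rw [← avg_const hn c, ← avg_add]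
    congr 1; ext j; rw [avg_const hn c]; ring
  have h2 : avg n (fun j => (x j + c) * (y j + c)) =
      avg n (fun j => x j * y j) + 2 * c * avg n (fun j => (x j + y j) / 2) + c ^ 2 := by
    conv_rhs => rw [← avg_const hn (c ^ 2)]
    rw [← avg_const_mul, ← avg_add, ← avg_add]
    congr 1; ext j; ring
  have h3 : avg n (fun j => ((x j + c) ^ 2 + (y j + c) ^ 2) / 2) =
      avg n (fun j => (x j ^ 2 + y j ^ 2) / 2) + 2 * c * avg n (fun j => (x j + y j) / 2)
        + c ^ 2 := by
    conv_rhs => rw [← avg_const hn (c ^ 2)]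
    rw [← avg_const_mul, ← avg_add, ← avg_add]
    congr 1; ext j; ring
  rw [pickFreeze_eq_div, pickFreeze_eq_div, pickFreezeNum, pickFreezeDen, h1, h2, h3,
    pickFreezeNum, pickFreezeDen]
  congr 1 <;> ring

/-- The size of the second-order effect of perturbing `x, y` by `g, h`. -/
def perturb (x y g h : ℝ) : ℝ := (|x| + |y| + (|g| + |h|)) * (|g| + |h|)

/-- By (A + B)² ≤ 2A² + 2B², where Jensen's inequality bounds the square of the mean perturbation B
by a mean of squares, which `perturb` dominates. -/
theorem avg_sq_perturb_le (n : ℕ) (x y g h : ℕ → ℝ) :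
    avg n (fun j => (x j + g j + (y j + h j)) / 2) ^ 2 ≤
      2 * avg n (fun j => (x j + y j) / 2) ^ 2 +
        avg n (fun j => perturb (x j) (y j) (g j) (h j)) := by
  have h1 : avg n (fun j => (x j + g j + (y j + h j)) / 2) =
      avg n (fun j => (x j + y j) / 2) + avg n (fun j => (g j + h j) / 2) := by
    rw [← avg_add]; congr 1; ext j; ring
  have h2 : 2 * avg n (fun j => (g j + h j) / 2) ^ 2 ≤
      avg n (fun j => perturb (x j) (y j) (g j) (h j)) := by
    calc _ ≤ 2 * avg n (fun j => ((g j + h j) / 2) ^ 2) := by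
          gcongr; exact avg_sq_le _ _
      _ = avg n (fun j => 2 * ((g j + h j) / 2) ^ 2) := (avg_const_mul _ _ _).symm
      _ ≤ _ := avg_mono n fun j => by
          have h3 : (g j + h j) ^ 2 ≤ (|g j| + |h j|) ^ 2 :=
            sq_le_sq' (by linarith [neg_abs_le (g j), neg_abs_le (h j)])
              (add_le_add (le_abs_self _) (le_abs_self _))
          have h4 : 0 ≤ (|x j| + |y j|) * (|g j| + |h j|) := by positivity
          unfold perturb
          nlinarith [sq_nonneg (g j + h j)]
  rw [h1]
  nlinarith [sq_nonneg (avg n (fun j => (x j + y j) / 2) - avg n (fun j => (g j + h j) / 2))]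

theorem abs_mul_perturb_sub_le (x y g h : ℝ) :
    |(x + g) * (y + h) - x * y| ≤ perturb x y g h := by
  have : (x + g) * (y + h) - x * y = x * h + g * y + g * h := by ring
  rw [this]
  refine (abs_add_three _ _ _).trans ?_
  simp only [abs_mul, perturb]
  have := abs_nonneg x; have := abs_nonneg y; have := abs_nonneg g; have := abs_nonneg h
  nlinarith [mul_nonneg (abs_nonneg x) (abs_nonneg g), mul_nonneg (abs_nonneg y) (abs_nonneg h),
    mul_nonneg (abs_nonneg g) (abs_nonneg h), sq_nonneg |g|, sq_nonneg |h|]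

theorem abs_sq_perturb_sub_le (x y g h : ℝ) :
    |((x + g) ^ 2 + (y + h) ^ 2) / 2 - (x ^ 2 + y ^ 2) / 2| ≤ perturb x y g h := by
  have : ((x + g) ^ 2 + (y + h) ^ 2) / 2 - (x ^ 2 + y ^ 2) / 2 =
      x * g + y * h + (g * g + h * h) / 2 := by ring
  rw [this]
  refine (abs_add_three _ _ _).trans ?_
  rw [abs_of_nonneg (a := (g * g + h * h) / 2)
    (div_nonneg (add_nonneg (mul_self_nonneg g) (mul_self_nonneg h)) two_pos.le),
    ← abs_mul_abs_self g, ← abs_mul_abs_self h]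
  simp only [abs_mul, perturb]
  nlinarith [mul_nonneg (abs_nonneg x) (abs_nonneg h), mul_nonneg (abs_nonneg y) (abs_nonneg g),
    mul_nonneg (abs_nonneg g) (abs_nonneg h), sq_nonneg |g|, sq_nonneg |h|]

/-- The error made when the centring of the pick-freeze statistics and the perturbation of the
outputs are both neglected. -/
def remainder (n : ℕ) (x y g h : ℕ → ℝ) : ℝ :=
  -- One average of `perturb` pays for the product or square terms; the other, with twice the
  -- squared mean, is the bound of `avg_sq_perturb_le`.
  2 * (avg n (fun j => perturb (x j) (y j) (g j) (h j)) + avg n (fun j => (x j + y j) / 2) ^ 2)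

theorem abs_pickFreezeNum_sub_le (n : ℕ) (x y g h : ℕ → ℝ) :
    |pickFreezeNum n (fun j => x j + g j) (fun j => y j + h j) - avg n (fun j => x j * y j)| ≤
      remainder n x y g h := by
  have h1 := avg_sq_perturb_le n x y g h
  have h2 : |avg n (fun j => (x j + g j) * (y j + h j)) - avg n (fun j => x j * y j)| ≤
      avg n (fun j => perturb (x j) (y j) (g j) (h j)) := by
    rw [← avg_sub]
    exact (abs_avg_le _ _).trans (avg_mono n fun j => abs_mul_perturb_sub_le _ _ _ _)
  rw [abs_le] at h2 ⊢
  have h3 := sq_nonneg (avg n (fun j => (x j + g j + (y j + h j)) / 2))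
  have h4 := sq_nonneg (avg n (fun j => (x j + y j) / 2))
  unfold pickFreezeNum remainder
  constructor <;> linarith

theorem abs_pickFreezeDen_sub_le (n : ℕ) (x y g h : ℕ → ℝ) :
    |pickFreezeDen n (fun j => x j + g j) (fun j => y j + h j) -
      avg n (fun j => (x j ^ 2 + y j ^ 2) / 2)| ≤ remainder n x y g h := by
  have h1 := avg_sq_perturb_le n x y g h
  have h2 : |avg n (fun j => ((x j + g j) ^ 2 + (y j + h j) ^ 2) / 2) -
      avg n (fun j => (x j ^ 2 + y j ^ 2) / 2)| ≤
      avg n (fun j => perturb (x j) (y j) (g j) (h j)) := by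
    rw [← avg_sub]
    exact (abs_avg_le _ _).trans (avg_mono n fun j => abs_sq_perturb_sub_le _ _ _ _)
  rw [abs_le] at h2 ⊢
  have h3 := sq_nonneg (avg n (fun j => (x j + g j + (y j + h j)) / 2))
  have h4 := sq_nonneg (avg n (fun j => (x j + y j) / 2))
  unfold pickFreezeDen remainder
  constructor <;> linarith

theorem abs_pickFreezeNum_sub_mul_den_sub_le (n : ℕ) (θ : ℝ) (x y g h : ℕ → ℝ) :
    |pickFreezeNum n (fun j => x j + g j) (fun j => y j + h j) -
        θ * pickFreezeDen n (fun j => x j + g j) (fun j => y j + h j) -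
      avg n (fun j => x j * y j - θ * ((x j ^ 2 + y j ^ 2) / 2))| ≤
      (1 + |θ|) * remainder n x y g h := by
  rw [avg_sub, avg_const_mul]
  have h1 := abs_pickFreezeNum_sub_le n x y g h
  have h2 := mul_le_mul_of_nonneg_left (abs_pickFreezeDen_sub_le n x y g h) (abs_nonneg θ)
  rw [← abs_mul] at h2
  have h3 : ∀ N D A B : ℝ, N - θ * D - (A - θ * B) = (N - A) - θ * (D - B) := by intros; ring
  rw [h3]
  refine (abs_sub _ _).trans ?_
  linarith

end Average

/-! ### Moment bounds for empirical means and negligible remainders -/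

section Probability

variable {Ω : Type*} [MeasurableSpace Ω] {Pr : Measure Ω}

theorem tendstoInMeasure_zero_of_abs_le {F B : ℕ → Ω → ℝ}
    (hF : ∀ n, AEStronglyMeasurable (F n) Pr) (hFB : ∀ n ω, |F n ω| ≤ B n ω)
    (hB : ∀ n, Integrable (B n) Pr) (h : Tendsto (fun n => ∫ ω, B n ω ∂Pr) atTop (𝓝 0)) :
    TendstoInMeasure Pr F atTop (fun _ => 0) := by
  refine tendstoInMeasure_of_tendsto_eLpNorm one_ne_zero hF aestronglyMeasurable_const ?_
  have h0 : Tendsto (fun n => ENNReal.ofReal (∫ ω, B n ω ∂Pr)) atTop (𝓝 0) := by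
    simpa using ENNReal.tendsto_ofReal h
  refine tendsto_of_tendsto_of_tendsto_of_le_of_le tendsto_const_nhds h0 (fun _ => zero_le)
    fun n => ?_
  have hpos : ∀ ω, 0 ≤ B n ω := fun ω => (abs_nonneg _).trans (hFB n ω)
  simp only [eLpNorm_one_eq_lintegral_enorm]
  rw [ofReal_integral_eq_lintegral_ofReal (hB n) (Eventually.of_forall hpos)]
  refine lintegral_mono fun ω => ?_
  simp only [Pi.sub_apply, sub_zero]
  rw [← ofReal_norm, Real.norm_eq_abs]
  exact ENNReal.ofReal_le_ofReal (hFB n ω)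

theorem integral_mul_le_sqrt_mul_sqrt {E : Type*} [MeasurableSpace E] {ν : Measure E}
    {x y : E → ℝ} (hx : MemLp x 2 ν) (hy : MemLp y 2 ν) (hx0 : ∀ e, 0 ≤ x e)
    (hy0 : ∀ e, 0 ≤ y e) :
    ∫ e, x e * y e ∂ν ≤ √(∫ e, x e ^ 2 ∂ν) * √(∫ e, y e ^ 2 ∂ν) := by
  have := integral_mul_le_Lp_mul_Lq_of_nonneg Real.HolderConjugate.two_two
    (Eventually.of_forall hx0) (Eventually.of_forall hy0) (by simpa using hx) (by simpa using hy)
  simpa [Real.sqrt_eq_rpow] using this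

/-- With U = |a| + |b| and V = |g| + |h|, the integrand is UV + V². Cauchy–Schwarz bounds √n ∫ UV by
‖U‖ √(n ∫ V²), and √n ≤ n handles the V² term. -/
theorem tendsto_sqrt_mul_integral_perturb {E : Type*} [MeasurableSpace E] {ν : Measure E}
    {a b : E → ℝ} (ha : MemLp a 2 ν) (hb : MemLp b 2 ν) {g h : ℕ → E → ℝ}
    (hg : ∀ n, MemLp (g n) 2 ν) (hh : ∀ n, MemLp (h n) 2 ν)
    (hg0 : Tendsto (fun n : ℕ => (n : ℝ) * ∫ e, g n e ^ 2 ∂ν) atTop (𝓝 0))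
    (hh0 : Tendsto (fun n : ℕ => (n : ℝ) * ∫ e, h n e ^ 2 ∂ν) atTop (𝓝 0)) :
    Tendsto (fun n : ℕ => √n * ∫ e, perturb (a e) (b e) (g n e) (h n e) ∂ν) atTop (𝓝 0) := by
  set U : E → ℝ := fun e => |a e| + |b e| with hU
  set V : ℕ → E → ℝ := fun n e => |g n e| + |h n e| with hV
  have hU2 : MemLp U 2 ν := ha.abs.add hb.abs
  have hV2 : ∀ n, MemLp (V n) 2 ν := fun n => (hg n).abs.add (hh n).abs
  have hV0 : Tendsto (fun n : ℕ => (n : ℝ) * ∫ e, V n e ^ 2 ∂ν) atTop (𝓝 0) := by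
    have hs : Tendsto (fun n : ℕ => 2 * ((n : ℝ) * ∫ e, g n e ^ 2 ∂ν) +
        2 * ((n : ℝ) * ∫ e, h n e ^ 2 ∂ν)) atTop (𝓝 0) := by
      simpa using (hg0.const_mul 2).add (hh0.const_mul 2)
    refine squeeze_zero (fun n => by positivity) (fun n => ?_) hs
    have hle : ∫ e, V n e ^ 2 ∂ν ≤ 2 * ∫ e, g n e ^ 2 ∂ν + 2 * ∫ e, h n e ^ 2 ∂ν := by
      rw [← integral_const_mul, ← integral_const_mul,
        ← integral_add ((hg n).integrable_sq.const_mul _) ((hh n).integrable_sq.const_mul _)]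
      refine integral_mono (hV2 n).integrable_sq
        (((hg n).integrable_sq.const_mul _).add ((hh n).integrable_sq.const_mul _)) fun e => ?_
      simp only [hV]
      nlinarith [sq_abs (g n e), sq_abs (h n e), sq_nonneg (|g n e| - |h n e|)]
    nlinarith [Nat.cast_nonneg (α := ℝ) n]
  have hs : Tendsto (fun n : ℕ => √(∫ e, U e ^ 2 ∂ν) * √((n : ℝ) * ∫ e, V n e ^ 2 ∂ν) +
      (n : ℝ) * ∫ e, V n e ^ 2 ∂ν) atTop (𝓝 0) := by
    simpa using (hV0.sqrt.const_mul (√(∫ e, U e ^ 2 ∂ν))).add hV0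
  refine squeeze_zero (fun n => mul_nonneg (Real.sqrt_nonneg _)
    (integral_nonneg fun e => by unfold perturb; positivity)) (fun n => ?_) hs
  have h1 : ∫ e, perturb (a e) (b e) (g n e) (h n e) ∂ν =
      ∫ e, U e * V n e ∂ν + ∫ e, V n e ^ 2 ∂ν := by
    have hUV : Integrable (fun e => U e * V n e) ν := hU2.integrable_mul (hV2 n)
    rw [← integral_add hUV (hV2 n).integrable_sq]
    congr 1; ext e; simp only [perturb, hU, hV]; ring
  have h2 := integral_mul_le_sqrt_mul_sqrt hU2 (hV2 n) (fun e => by positivity)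
    fun e => by positivity
  have h3 : √(n : ℝ) ≤ n := by
    rw [Real.sqrt_le_left (Nat.cast_nonneg n)]
    exact_mod_cast Nat.le_self_pow two_ne_zero n
  have h4 : 0 ≤ ∫ e, V n e ^ 2 ∂ν := integral_nonneg fun e => sq_nonneg _
  rw [h1, mul_add, Real.sqrt_mul (Nat.cast_nonneg n)]
  refine add_le_add ?_ (mul_le_mul_of_nonneg_right h3 h4)
  calc √(n : ℝ) * ∫ e, U e * V n e ∂ν
      ≤ √n * (√(∫ e, U e ^ 2 ∂ν) * √(∫ e, V n e ^ 2 ∂ν)) := by gcongr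
    _ = _ := by ring

variable {E : Type*} [MeasurableSpace E] {ν : Measure E} {Z : ℕ → Ω → E}

theorem memLp_comp_hasLaw {q : ENNReal} {Y : Ω → E} (hY : HasLaw Y ν Pr) {k : E → ℝ}
    (hk : MemLp k q ν) : MemLp (fun ω => k (Y ω)) q Pr := by
  rw [← hY.map_eq] at hk
  exact hk.comp_of_map hY.aemeasurable

theorem integral_comp_hasLaw {Y : Ω → E} (hY : HasLaw Y ν Pr) {k : E → ℝ}
    (hk : AEStronglyMeasurable k ν) : ∫ ω, k (Y ω) ∂Pr = ∫ e, k e ∂ν :=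
  hY.integral_comp hk

theorem integrable_avg (hZ : ∀ j, HasLaw (Z j) ν Pr) (n : ℕ) {k : E → ℝ} (hk : Integrable k ν) :
    Integrable (fun ω => avg n fun j => k (Z j ω)) Pr :=
  (integrable_finsetSum _ fun j _ => memLp_one_iff_integrable.1
    (memLp_comp_hasLaw (hZ j) (memLp_one_iff_integrable.2 hk))).const_mul _

/-- Equality holds for n ≥ 1; the empirical mean is 0 at n = 0, whence the sign condition. -/
theorem integral_avg_le (hZ : ∀ j, HasLaw (Z j) ν Pr) (n : ℕ) {k : E → ℝ} (hk : Integrable k ν)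
    (hk0 : 0 ≤ ∫ e, k e ∂ν) :
    ∫ ω, avg n (fun j => k (Z j ω)) ∂Pr ≤ ∫ e, k e ∂ν := by
  unfold avg
  rw [integral_const_mul, integral_finsetSum _ fun j _ => memLp_one_iff_integrable.1
    (memLp_comp_hasLaw (hZ j) (memLp_one_iff_integrable.2 hk))]
  simp_rw [fun j => integral_comp_hasLaw (hZ j) hk.aestronglyMeasurable]
  rcases Nat.eq_zero_or_pos n with rfl | hn
  · simpa using hk0
  · have : (n : ℝ) ≠ 0 := by positivity
    simp [this]

theorem memLp_avg (hZ : ∀ j, HasLaw (Z j) ν Pr) (n : ℕ) {k : E → ℝ} (hk : MemLp k 2 ν) :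
    MemLp (fun ω => avg n fun j => k (Z j ω)) 2 Pr :=
  (memLp_finsetSum _ fun j _ => memLp_comp_hasLaw (hZ j) hk).const_mul _

theorem integral_avg_sq [IsProbabilityMeasure Pr] (hZ : ∀ j, HasLaw (Z j) ν Pr) (hind : iIndepFun Z Pr) (n : ℕ)
    {k : E → ℝ} (hkm : Measurable k) (hk : MemLp k 2 ν) (hk0 : ∫ e, k e ∂ν = 0) :
    ∫ ω, avg n (fun j => k (Z j ω)) ^ 2 ∂Pr = (∫ e, k e ^ 2 ∂ν) / n := by
  have hL : ∀ j, MemLp (fun ω => k (Z j ω)) 2 Pr := fun j => memLp_comp_hasLaw (hZ j) hk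
  have hm : ∀ j, ∫ ω, k (Z j ω) ∂Pr = 0 := fun j => by
    rw [integral_comp_hasLaw (hZ j) hk.1, hk0]
  have hv : ∀ j, variance (fun ω => k (Z j ω)) Pr = ∫ e, k e ^ 2 ∂ν := fun j => by
    rw [variance_of_integral_eq_zero (hL j).1.aemeasurable (hm j)]
    exact integral_comp_hasLaw (hZ j) (k := fun e => k e ^ 2) (hk.1.pow 2)
  have hs : ∫ ω, (∑ j ∈ Finset.range n, fun ω => k (Z j ω)) ω ∂Pr = 0 := by
    simp only [Finset.sum_apply]
    rw [integral_finsetSum _ fun j _ => (hL j).integrable one_le_two]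
    simp [hm]
  have h1 := IndepFun.variance_sum (s := Finset.range n) (X := fun j ω => k (Z j ω)) (μ := Pr)
    (fun j _ => hL j) fun i _ j _ hij => (hind.indepFun hij).comp hkm hkm
  rw [variance_of_integral_eq_zero
    (Finset.aemeasurable_sum _ fun j _ => (hL j).1.aemeasurable) hs] at h1
  simp only [hv, Finset.sum_const, Finset.card_range, nsmul_eq_mul, Finset.sum_apply] at h1
  simp_rw [avg, mul_pow]
  rw [integral_const_mul, h1]
  rcases Nat.eq_zero_or_pos n with rfl | hn
  · simp
  · field_simp

end Probability

/-! ### Slutsky-type limits of coverage probabilities -/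

section Slutsky

variable {Ω : Type*} [MeasurableSpace Ω] {Pr : Measure Ω}

theorem tendstoInMeasure_add_const {F G : ℕ → Ω → ℝ} {c d : ℝ}
    (hF : TendstoInMeasure Pr F atTop (fun _ => c))
    (hG : TendstoInMeasure Pr G atTop (fun _ => d)) :
    TendstoInMeasure Pr (fun n ω => F n ω + G n ω) atTop (fun _ => c + d) := by
  rw [tendstoInMeasure_iff_norm] at *
  intro ε hε
  have h := (hF (ε / 2) (half_pos hε)).add (hG (ε / 2) (half_pos hε))
  rw [add_zero] at h
  refine tendsto_of_tendsto_of_tendsto_of_le_of_le tendsto_const_nhds h (fun _ => zero_le)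
    fun n => (measure_mono fun ω hω => ?_).trans (measure_union_le _ _)
  simp only [Set.mem_union, Set.mem_ofPred_eq] at hω ⊢
  by_contra! hlt
  have := norm_add_le (F n ω - c) (G n ω - d)
  rw [show F n ω - c + (G n ω - d) = F n ω + G n ω - (c + d) by ring] at this
  linarith

variable [IsProbabilityMeasure Pr]

/-- Coverage of a studentized interval in product form: no division by the random scale. -/
theorem tendsto_coverage_of_tendstoInDistribution {U V D : ℕ → Ω → ℝ} {s σ τ z : ℝ}
    (hτ : 0 < τ) (hsσ : s * σ = τ) (hz : 0 < z)
    (hU : TendstoInDistribution U atTop (fun x => τ * x) (fun _ => Pr) (gaussianReal 0 1))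
    (hV : TendstoInMeasure Pr V atTop (fun _ => s)) (hVm : ∀ n, AEMeasurable (V n) Pr)
    (hD : TendstoInMeasure Pr D atTop (fun _ => σ)) (hDm : ∀ n, AEMeasurable (D n) Pr) :
    Tendsto (fun n => Pr.real {ω | |U n ω| ≤ z * (V n ω * D n ω)}) atTop
      (𝓝 ((gaussianReal 0 1).real {x | |x| ≤ z})) := by
  -- Slutsky's lemma is used twice, adjoining V and then D to U.
  have h1 := hU.prodMk_of_tendstoInMeasure_const U V _ hV hVm
  have h2 := h1.continuous_comp_prodMk_of_tendstoInMeasure_const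
    (g := fun q : (ℝ × ℝ) × ℝ => |q.1.1| - z * (q.1.2 * q.2)) (by fun_prop) hD hDm
  have hna : NullSingletonClass (gaussianReal 0 1) := nullSingletonClass_gaussianReal one_ne_zero
  have hset : (fun x : ℝ => |τ * x| - z * (s * σ)) ⁻¹' Set.Iic 0 = {x | |x| ≤ z} := by
    ext x
    simp only [Set.mem_preimage, Set.mem_Iic, Set.mem_ofPred_eq, hsσ, abs_mul, abs_of_pos hτ]
    rw [sub_nonpos, mul_comm z, mul_le_mul_iff_right₀ hτ]
  have hfr : (fun x : ℝ => |τ * x| - z * (s * σ)) ⁻¹' {0} ⊆ {z, -z} := by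
    intro x hx
    simp only [Set.mem_preimage, Set.mem_singleton_iff, hsσ, abs_mul, abs_of_pos hτ] at hx
    have : |x| = z := mul_left_cancel₀ hτ.ne' (by linarith)
    exact (abs_eq hz.le).1 this
  -- Portmanteau: under the limit law the boundary {0} pulls back into {z, -z}, which is
  -- Gaussian-null.
  have h3 := ProbabilityMeasure.tendsto_measure_of_null_frontier_of_tendsto' h2.tendsto
    (E := Set.Iic 0) (by
      rw [frontier_Iic]
      simp only [ProbabilityMeasure.coe_mk]
      rw [Measure.map_apply (by fun_prop) (measurableSet_singleton 0)]
      exact measure_mono_null hfr ((Set.toFinite _).measure_zero _))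
  simp only [ProbabilityMeasure.coe_mk] at h3
  rw [Measure.map_apply (by fun_prop) measurableSet_Iic, hset] at h3
  have h4 := (ENNReal.tendsto_toReal (measure_ne_top _ _)).comp h3
  refine h4.congr fun n => ?_
  rw [Function.comp_apply, Measure.map_apply_of_aemeasurable (h2.forall_aemeasurable n) measurableSet_Iic,
    measureReal_def]
  congr 2
  ext ω
  simp

theorem tendsto_measureReal_nonpos {D : ℕ → Ω → ℝ} {σ : ℝ} (hσ : 0 < σ)
    (hD : TendstoInMeasure Pr D atTop (fun _ => σ)) :
    Tendsto (fun n => Pr.real {ω | D n ω ≤ 0}) atTop (𝓝 0) := by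
  have h := (ENNReal.tendsto_toReal ENNReal.zero_ne_top).comp
    (tendstoInMeasure_iff_norm.1 hD σ hσ)
  refine squeeze_zero (fun _ => measureReal_nonneg) (fun n => ?_) h
  refine measureReal_mono (fun ω hω => ?_)
  have : D n ω ≤ 0 := hω
  simp only [Set.mem_ofPred_eq, Real.norm_eq_abs]
  rw [abs_sub_comm]
  exact (by linarith : σ ≤ σ - D n ω).trans (le_abs_self _)

theorem tendsto_measureReal_congr_off {A B C : ℕ → Set Ω} {l : ℝ}
    (hC : Tendsto (fun n => Pr.real (C n)) atTop (𝓝 0))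
    (hB : Tendsto (fun n => Pr.real (B n)) atTop (𝓝 l))
    (h : ∀ᶠ n in atTop, ∀ ω ∉ C n, (ω ∈ A n ↔ ω ∈ B n)) :
    Tendsto (fun n => Pr.real (A n)) atTop (𝓝 l) := by
  refine tendsto_of_tendsto_of_tendsto_of_le_of_le' (by simpa using hB.sub hC)
    (by simpa using hB.add hC) ?_ ?_
  · filter_upwards [h] with n hn
    have : B n ⊆ A n ∪ C n := fun ω hω => by
      by_cases hc : ω ∈ C n
      · exact Or.inr hc
      · exact Or.inl ((hn ω hc).2 hω)
    linarith [(measureReal_mono this).trans (measureReal_union_le (μ := Pr) (A n) (C n))]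
  · filter_upwards [h] with n hn
    have : A n ⊆ B n ∪ C n := fun ω hω => by
      by_cases hc : ω ∈ C n
      · exact Or.inr hc
      · exact Or.inl ((hn ω hc).1 hω)
    exact (measureReal_mono this).trans (measureReal_union_le _ _)

end Slutsky

/-! ### Central limit theorem and coverage for perturbed pick-freeze pairs -/

section Core

variable {Ω : Type*} [MeasurableSpace Ω] {Pr : Measure Ω} [IsProbabilityMeasure Pr]
  {E : Type*} [MeasurableSpace E] {ν : Measure E} {Z : ℕ → Ω → E}


/-- The law of large numbers in probability. -/
theorem tendstoInMeasure_avg (hZ : ∀ j, HasLaw (Z j) ν Pr) (hind : iIndepFun Z Pr) {k : E → ℝ}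
    (hkm : Measurable k) (hk : Integrable k ν) :
    TendstoInMeasure Pr (fun n ω => avg n fun j => k (Z j ω)) atTop (fun _ => ∫ e, k e ∂ν) := by
  have hid : ∀ j, IdentDistrib (fun ω => k (Z j ω)) (fun ω => k (Z 0 ω)) Pr Pr := fun j =>
    IdentDistrib.comp ⟨(hZ j).aemeasurable, (hZ 0).aemeasurable,
      (hZ j).map_eq.trans (hZ 0).map_eq.symm⟩ hkm
  have h := strong_law_ae_real (μ := Pr) (fun j ω => k (Z j ω))
    (memLp_one_iff_integrable.1 (memLp_comp_hasLaw (hZ 0) (memLp_one_iff_integrable.2 hk)))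
    (fun i j hij => (hind.indepFun hij).comp hkm hkm) hid
  rw [integral_comp_hasLaw (hZ 0) hk.aestronglyMeasurable] at h
  refine tendstoInMeasure_of_tendsto_ae
    (fun n => (integrable_avg hZ n hk).aestronglyMeasurable) ?_
  filter_upwards [h] with ω hω
  refine hω.congr fun n => ?_
  rw [avg]; ring

/-- The central limit theorem for empirical means of a centred function of a sample. -/
theorem tendstoInDistribution_sqrt_mul_avg [IsFiniteMeasure ν] (hZ : ∀ j, HasLaw (Z j) ν Pr)
    (hind : iIndepFun Z Pr) {k : E → ℝ} (hkm : Measurable k) (hk : MemLp k 2 ν)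
    (hk0 : ∫ e, k e ∂ν = 0) {τ : ℝ} (hτ : τ ^ 2 = variance k ν) :
    TendstoInDistribution (fun (n : ℕ) ω => √(n : ℝ) * avg n fun j => k (Z j ω)) atTop
      (fun x => τ * x) (fun _ => Pr) (gaussianReal 0 1) := by
  have hid : ∀ j, IdentDistrib (fun ω => k (Z j ω)) (fun ω => k (Z 0 ω)) Pr Pr := fun j =>
    IdentDistrib.comp ⟨(hZ j).aemeasurable, (hZ 0).aemeasurable,
      (hZ j).map_eq.trans (hZ 0).map_eq.symm⟩ hkm
  have hmean : ∫ ω, k (Z 0 ω) ∂Pr = 0 := by rw [integral_comp_hasLaw (hZ 0) hk.1, hk0]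
  have hv : variance (fun ω => k (Z 0 ω)) Pr = τ ^ 2 := by
    rw [hτ, variance_of_integral_eq_zero (memLp_comp_hasLaw (hZ 0) hk).1.aemeasurable hmean,
      variance_of_integral_eq_zero hk.1.aemeasurable hk0]
    exact integral_comp_hasLaw (hZ 0) (k := fun e => k e ^ 2) (hk.1.pow 2)
  have hlaw : HasLaw (fun x : ℝ => τ * x)
      (gaussianReal 0 (variance (fun ω => k (Z 0 ω)) Pr).toNNReal) (gaussianReal 0 1) := by
    have := gaussianReal_const_mul (HasLaw.id (μ := gaussianReal 0 1)) τ
    have hvar : (variance (fun ω => k (Z 0 ω)) Pr).toNNReal = .mk (τ ^ 2) (sq_nonneg τ) * 1 := by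
      rw [hv]; ext; simp [sq_nonneg]
    rw [mul_zero, ← hvar] at this
    exact this
  have h := tendstoInDistribution_inv_sqrt_mul_sum_sub (P := Pr) hlaw
    (memLp_comp_hasLaw (hZ 0) hk) (X := fun j ω => k (Z j ω))
    (hind.comp (fun _ => k) fun _ => hkm) hid
  convert h using 3 with n ω
  rw [hmean, mul_zero, sub_zero, avg, ← mul_assoc]
  congr 1
  rcases Nat.eq_zero_or_pos n with rfl | hn
  · simp
  · have : (0 : ℝ) < n := by exact_mod_cast hn
    rw [mul_one_div, Real.sqrt_div_self]

theorem memLp_sq_of_integrable_pow_four {a : E → ℝ} (ha : Measurable a)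
    (ha4 : Integrable (fun e => a e ^ 4) ν) : MemLp (fun e => a e ^ 2) 2 ν := by
  refine (memLp_two_iff_integrable_sq (ha.pow_const 2).aestronglyMeasurable).2 ?_
  simpa only [← pow_mul] using ha4

theorem memLp_two_of_integrable_pow_four [IsFiniteMeasure ν] {a : E → ℝ} (ha : Measurable a)
    (ha4 : Integrable (fun e => a e ^ 4) ν) : MemLp a 2 ν :=
  (memLp_two_iff_integrable_sq ha.aestronglyMeasurable).2
    ((memLp_sq_of_integrable_pow_four ha ha4).integrable one_le_two)

/-- Asymptotic coverage of the pick-freeze confidence interval computed from perturbed outputs, for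
centred outputs `a`, `b` of equal variance and perturbations `g n`, `h n` of size `o(n ^ (-1/2))` in
quadratic mean. -/
theorem tendsto_pickFreeze_coverage [IsProbabilityMeasure ν] (hZ : ∀ j, HasLaw (Z j) ν Pr) (hind : iIndepFun Z Pr)
    {a b : E → ℝ} (ham : Measurable a) (hbm : Measurable b) (ha4 : Integrable (fun e => a e ^ 4) ν)
    (hb4 : Integrable (fun e => b e ^ 4) ν) (ha0 : ∫ e, a e ∂ν = 0) (hb0 : ∫ e, b e ∂ν = 0) {σ θ s z : ℝ}
    (hσ : 0 < σ) (hσa : ∫ e, a e ^ 2 ∂ν = σ) (hσb : ∫ e, b e ^ 2 ∂ν = σ)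
    (hθ : ∫ e, a e * b e ∂ν = θ * σ) (hs : 0 < s)
    (hvar : (s * σ) ^ 2 = variance (fun e => a e * b e - θ * ((a e ^ 2 + b e ^ 2) / 2)) ν)
    {g h : ℕ → E → ℝ} (hgm : ∀ n, Measurable (g n)) (hhm : ∀ n, Measurable (h n))
    (hg : ∀ n, MemLp (g n) 2 ν) (hh : ∀ n, MemLp (h n) 2 ν)
    (hg0 : Tendsto (fun n : ℕ => (n : ℝ) * ∫ e, g n e ^ 2 ∂ν) atTop (𝓝 0))
    (hh0 : Tendsto (fun n : ℕ => (n : ℝ) * ∫ e, h n e ^ 2 ∂ν) atTop (𝓝 0))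
    {v : ℕ → Ω → ℝ} (hv : IsConsistent Pr v s) (hz : 0 < z) :
    Tendsto (fun n => Pr.real {ω | |pickFreeze n (fun j => a (Z j ω) + g n (Z j ω))
        (fun j => b (Z j ω) + h n (Z j ω)) - θ| ≤ z * (v n ω / √(n : ℝ))}) atTop
      (𝓝 ((gaussianReal 0 1).real {x | |x| ≤ z})) := by
  have haa : MemLp (fun e => a e ^ 2) 2 ν := memLp_sq_of_integrable_pow_four ham ha4
  have hbb : MemLp (fun e => b e ^ 2) 2 ν := memLp_sq_of_integrable_pow_four hbm hb4
  have ha2 : MemLp a 2 ν := memLp_two_of_integrable_pow_four ham ha4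
  have hb2 : MemLp b 2 ν := memLp_two_of_integrable_pow_four hbm hb4
  have hZm : ∀ j, AEMeasurable (Z j) Pr := fun j => (hZ j).aemeasurable
  have hcm : ∀ (k : E → ℝ), Measurable k → ∀ n,
      AEMeasurable (fun ω => avg n fun j => k (Z j ω)) Pr := fun k hk n =>
    (Finset.aemeasurable_fun_sum _ fun j _ => hk.comp_aemeasurable (hZm j)).const_mul _
  let N : ℕ → Ω → ℝ := fun n ω => pickFreezeNum n (fun j => a (Z j ω) + g n (Z j ω))
    (fun j => b (Z j ω) + h n (Z j ω))
  let D : ℕ → Ω → ℝ := fun n ω => pickFreezeDen n (fun j => a (Z j ω) + g n (Z j ω))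
    (fun j => b (Z j ω) + h n (Z j ω))
  let R : ℕ → Ω → ℝ := fun n ω => remainder n (fun j => a (Z j ω)) (fun j => b (Z j ω))
    (fun j => g n (Z j ω)) (fun j => h n (Z j ω))
  have hNm : ∀ n, AEMeasurable (N n) Pr := fun n =>
    (hcm (fun e => (a e + g n e) * (b e + h n e)) (by fun_prop) n).sub
      ((hcm (fun e => (a e + g n e + (b e + h n e)) / 2) (by fun_prop) n).pow_const 2)
  have hDm : ∀ n, AEMeasurable (D n) Pr := fun n =>
    (hcm (fun e => ((a e + g n e) ^ 2 + (b e + h n e) ^ 2) / 2) (by fun_prop) n).sub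
      ((hcm (fun e => (a e + g n e + (b e + h n e)) / 2) (by fun_prop) n).pow_const 2)
  -- the remainder is negligible at the rate of the central limit theorem
  have hkint : ∀ n, Integrable (fun e => perturb (a e) (b e) (g n e) (h n e)) ν := fun n =>
    ((ha2.abs.add hb2.abs).add ((hg n).abs.add (hh n).abs)).integrable_mul
      ((hg n).abs.add (hh n).abs)
  have hk0 : ∀ n, 0 ≤ ∫ e, perturb (a e) (b e) (g n e) (h n e) ∂ν := fun n =>
    integral_nonneg fun e => by unfold perturb; positivity
  have hM2 : MemLp (fun e => (a e + b e) / 2) 2 ν := by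
    simpa [div_eq_inv_mul] using (ha2.add hb2).const_mul (2⁻¹ : ℝ)
  have hM0 : ∫ e, (a e + b e) / 2 ∂ν = 0 := by
    rw [integral_div, integral_add (ha2.integrable one_le_two) (hb2.integrable one_le_two),
      ha0, hb0]
    simp
  have hRint : ∀ n, Integrable (R n) Pr := fun n =>
    ((integrable_avg hZ n (hkint n)).add (memLp_avg hZ n hM2).integrable_sq).const_mul 2
  have hRle : ∀ n, ∫ ω, R n ω ∂Pr ≤ 2 * (∫ e, perturb (a e) (b e) (g n e) (h n e) ∂ν +
      (∫ e, ((a e + b e) / 2) ^ 2 ∂ν) / n) := fun n => by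
    simp only [R, remainder]
    rw [integral_const_mul, integral_add (integrable_avg hZ n (hkint n))
      (memLp_avg hZ n hM2).integrable_sq,
      integral_avg_sq hZ hind n (k := fun e => (a e + b e) / 2) (by fun_prop) hM2 hM0]
    gcongr
    exact integral_avg_le hZ n (hkint n) (hk0 n)
  have hR0 : ∀ n ω, 0 ≤ R n ω := fun n ω =>
    (abs_nonneg _).trans (abs_pickFreezeNum_sub_le n (fun j => a (Z j ω)) (fun j => b (Z j ω))
    (fun j => g n (Z j ω)) (fun j => h n (Z j ω)))
  have hRlim : Tendsto (fun n : ℕ => √(n : ℝ) * ∫ ω, R n ω ∂Pr) atTop (𝓝 0) := by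
    have h1 := tendsto_sqrt_mul_integral_perturb ha2 hb2 hg hh hg0 hh0
    have h2 : Tendsto (fun n : ℕ => (√(n : ℝ))⁻¹) atTop (𝓝 0) :=
      tendsto_inv_atTop_zero.comp (Real.tendsto_sqrt_atTop.comp tendsto_natCast_atTop_atTop)
    have h3 : Tendsto (fun n : ℕ => 2 * (√(n : ℝ) * ∫ e, perturb (a e) (b e) (g n e) (h n e) ∂ν +
        (∫ e, ((a e + b e) / 2) ^ 2 ∂ν) * (√(n : ℝ))⁻¹)) atTop (𝓝 0) := by
      simpa using (h1.add (h2.const_mul (∫ e, ((a e + b e) / 2) ^ 2 ∂ν))).const_mul 2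
    refine squeeze_zero (fun n => mul_nonneg (Real.sqrt_nonneg _)
      (integral_nonneg (hR0 n))) (fun n => ?_) h3
    refine (mul_le_mul_of_nonneg_left (hRle n) (Real.sqrt_nonneg _)).trans (le_of_eq ?_)
    have : (√(n : ℝ))⁻¹ = √n / n := Real.sqrt_div_self.symm
    rw [this]; ring
  -- the numerator
  have hW : TendstoInDistribution
      (fun (n : ℕ) ω => √(n : ℝ) * avg n fun j => a (Z j ω) * b (Z j ω) -
        θ * ((a (Z j ω) ^ 2 + b (Z j ω) ^ 2) / 2)) atTop
      (fun x => s * σ * x) (fun _ => Pr) (gaussianReal 0 1) := by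
    have hab : MemLp (fun e => a e * b e) 2 ν := by
      refine (memLp_two_iff_integrable_sq (ham.mul hbm).aestronglyMeasurable).2 ?_
      exact (haa.integrable_mul hbb).congr (Eventually.of_forall fun e => (mul_pow _ _ 2).symm)
    have hq : MemLp (fun e => (a e ^ 2 + b e ^ 2) / 2) 2 ν := by
      simpa [div_eq_inv_mul] using (haa.add hbb).const_mul (2⁻¹ : ℝ)
    refine tendstoInDistribution_sqrt_mul_avg hZ hind
      (k := fun e => a e * b e - θ * ((a e ^ 2 + b e ^ 2) / 2)) (by fun_prop)
      (hab.sub (hq.const_mul θ)) ?_ hvar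
    rw [integral_sub (hab.integrable one_le_two) ((hq.integrable one_le_two).const_mul θ),
      integral_const_mul, integral_div, integral_add ha2.integrable_sq hb2.integrable_sq, hθ,
      hσa, hσb]
    ring
  have hU : TendstoInDistribution (fun (n : ℕ) ω => √(n : ℝ) * (N n ω - θ * D n ω)) atTop
      (fun x => s * σ * x) (fun _ => Pr) (gaussianReal 0 1) := by
    have hUm : ∀ n : ℕ, AEMeasurable (fun ω => √(n : ℝ) * (N n ω - θ * D n ω)) Pr := fun n =>
      ((hNm n).sub ((hDm n).const_mul θ)).const_mul _
    refine tendstoInDistribution_of_tendstoInMeasure_sub _ _ hW ?_ hUm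
    refine tendstoInMeasure_zero_of_abs_le
      (B := fun n ω => (1 + |θ|) * (√(n : ℝ) * R n ω))
      (fun n => ((hUm n).sub (hW.forall_aemeasurable n)).aestronglyMeasurable)
      (fun n ω => ?_) (fun n => ((hRint n).const_mul _).const_mul _) ?_
    · simp only [Pi.sub_apply]
      rw [← mul_sub, abs_mul, abs_of_nonneg (Real.sqrt_nonneg _), mul_left_comm]
      exact mul_le_mul_of_nonneg_left (abs_pickFreezeNum_sub_mul_den_sub_le n θ _ _ _ _)
        (Real.sqrt_nonneg _)
    · simp_rw [integral_const_mul]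
      simpa using hRlim.const_mul (1 + |θ|)
  -- the denominator
  have hDlim : TendstoInMeasure Pr D atTop (fun _ => σ) := by
    have hq : Integrable (fun e => (a e ^ 2 + b e ^ 2) / 2) ν :=
      (ha2.integrable_sq.add hb2.integrable_sq).div_const 2
    have h1 := tendstoInMeasure_avg hZ hind (k := fun e => (a e ^ 2 + b e ^ 2) / 2)
      (by fun_prop) hq
    have h2 : ∫ e, (a e ^ 2 + b e ^ 2) / 2 ∂ν = σ := by
      rw [integral_div, integral_add ha2.integrable_sq hb2.integrable_sq, hσa, hσb]; ring
    rw [h2] at h1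
    have h3 : TendstoInMeasure Pr
        (fun n ω => D n ω - avg n fun j => (a (Z j ω) ^ 2 + b (Z j ω) ^ 2) / 2) atTop
        (fun _ => 0) := by
      refine tendstoInMeasure_zero_of_abs_le (B := R)
        (fun n => ((hDm n).sub (hcm (fun e => (a e ^ 2 + b e ^ 2) / 2)
          (by fun_prop) n)).aestronglyMeasurable)
        (fun n ω => abs_pickFreezeDen_sub_le n _ _ _ _) hRint ?_
      -- Since √n ≥ 1 for n ≥ 1, the integral of R is bounded by its √n multiple, which tends to 0.
      refine squeeze_zero' (Eventually.of_forall fun n => integral_nonneg (hR0 n)) ?_ hRlim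
      filter_upwards [eventually_ge_atTop 1] with n hn
      have : (1 : ℝ) ≤ √(n : ℝ) := Real.one_le_sqrt.2 (by exact_mod_cast hn)
      exact le_mul_of_one_le_left (integral_nonneg (hR0 n)) this
    simpa using tendstoInMeasure_add_const h3 h1
  have hcov := tendsto_coverage_of_tendstoInDistribution (mul_pos hs hσ) rfl hz hU hv.2 hv.1
    hDlim hDm
  -- Clearing the denominator is an equivalence only where D > 0; the exceptional event D ≤ 0 has
  -- probability tending to 0.
  refine tendsto_measureReal_congr_off (tendsto_measureReal_nonpos hσ hDlim) hcov ?_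
  filter_upwards [eventually_ge_atTop 1] with n hn ω hω
  have hDpos : 0 < D n ω := not_le.1 hω
  have hn0 : (0 : ℝ) < √(n : ℝ) := Real.sqrt_pos.2 (by exact_mod_cast hn)
  simp only [pickFreeze_eq_div]
  change |N n ω / D n ω - θ| ≤ _ ↔ _
  have h1 : N n ω / D n ω - θ = (N n ω - θ * D n ω) / D n ω := by field_simp
  rw [h1, abs_div, abs_of_pos hDpos, div_le_iff₀ hDpos, abs_mul, abs_of_pos hn0,
    ← mul_le_mul_iff_right₀ hn0]
  have h2 : √(n : ℝ) * (z * (v n ω / √(n : ℝ)) * D n ω) = z * (v n ω * D n ω) := by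
    field_simp
  rw [h2]

end Core

/-! ### From the metamodel assumptions to coverage of the closed index -/

section Metamodel

variable {p : ℕ} {P : Fin p → Measure ℝ} {f : (Fin p → ℝ) → ℝ}

open Classical in
/-- The centred discrepancy between a metamodel and the model, when it is square integrable. -/
def discrepancy (P : Fin p → Measure ℝ) (f g : (Fin p → ℝ) → ℝ) (x : Fin p → ℝ) : ℝ :=
  -- The default 0 keeps every error in L², including for the finitely many n where the metamodel
  -- error need not be.
  if MemLp (fun x => g x - f x) 2 (Measure.pi P) then
    g x - f x - ∫ y, g y - f y ∂(Measure.pi P)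
  else 0

theorem measurable_discrepancy (hf : Measurable f) {g : (Fin p → ℝ) → ℝ} (hg : Measurable g) :
    Measurable (discrepancy P f g) := by
  unfold discrepancy
  split_ifs
  · exact (hg.sub hf).sub_const _
  · exact measurable_const

theorem integral_discrepancy_sq {g : (Fin p → ℝ) → ℝ}
    (h : MemLp (fun x => g x - f x) 2 (Measure.pi P)) :
    ∫ x, discrepancy P f g x ^ 2 ∂(Measure.pi P) =
      variance (fun x => g x - f x) (Measure.pi P) := by
  rw [variance_eq_integral h.1.aemeasurable]
  simp only [discrepancy, if_pos h]

variable [∀ i, IsProbabilityMeasure (P i)]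

theorem integrable_sub_const_pow_four (hf : Measurable f)
    (hf4 : Integrable (fun x => f x ^ 4) (Measure.pi P)) (c : ℝ) :
    Integrable (fun x => (f x - c) ^ 4) (Measure.pi P) := by
  refine ((hf4.add (integrable_const (c ^ 4))).const_mul 8).mono'
    ((hf.sub_const c).pow_const 4).aestronglyMeasurable (Eventually.of_forall fun x => ?_)
  rw [Real.norm_of_nonneg (by positivity)]
  simp only [Pi.add_apply]
  nlinarith [sq_nonneg (f x + c), sq_nonneg (f x - c), sq_nonneg (f x ^ 2 - c ^ 2),
    sq_nonneg ((f x + c) ^ 2), mul_nonneg (sq_nonneg (f x + c)) (sq_nonneg (f x + c)),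
    mul_nonneg (sq_nonneg (f x - c)) (sq_nonneg (f x + c))]

theorem memLp_discrepancy (g : (Fin p → ℝ) → ℝ) :
    MemLp (discrepancy P f g) 2 (Measure.pi P) := by
  unfold discrepancy
  split_ifs with h
  · exact h.sub (memLp_const _)
  · exact memLp_const 0

/-- This is where L² convergence enters. The real-valued `variance` is 0 by default when the true
variance is infinite, so the condition on n Var alone does not give square integrability. -/
theorem eventually_memLp_sub (hf : Measurable f) {ft : ℕ → (Fin p → ℝ) → ℝ}
    (hft : ∀ n, Measurable (ft n)) {c : ℝ}
    (h : Tendsto (fun n => eLpNorm (fun x => ft n x - f x - c) 2 (Measure.pi P)) atTop (𝓝 0)) :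
    ∀ᶠ n in atTop, MemLp (fun x => ft n x - f x) 2 (Measure.pi P) := by
  filter_upwards [h.eventually (gt_mem_nhds ENNReal.zero_lt_top)] with n hn
  have h1 : MemLp (fun x => ft n x - f x - c) 2 (Measure.pi P) :=
    ⟨(((hft n).sub hf).sub_const c).aestronglyMeasurable, hn⟩
  exact (h1.add (memLp_const c)).ae_eq (Eventually.of_forall fun x => sub_add_cancel _ c)

/-- Y and Y_u have the same mean because resampling preserves the law, so the integral is their
covariance and `closedIndex_eq` applies. It makes the limiting summand k centred. -/
theorem integral_centred_mul_piecewise (hfm : Measurable f) (hf : MemLp f 2 (Measure.pi P))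
    (hvar : variance f (Measure.pi P) ≠ 0) (u : Finset (Fin p)) :
    ∫ z : (Fin p → ℝ) × (Fin p → ℝ), (f z.1 - ∫ x, f x ∂(Measure.pi P)) *
        (f (u.piecewise z.1 z.2) - ∫ x, f x ∂(Measure.pi P))
        ∂((Measure.pi P).prod (Measure.pi P)) =
      closedIndex P f u * variance f (Measure.pi P) := by
  rw [closedIndex_eq P hfm hf, div_mul_cancel₀ _ hvar, crossMoment]
  set m := ∫ x, f x ∂(Measure.pi P) with hm
  have h1 : MemLp (fun z : (Fin p → ℝ) × (Fin p → ℝ) => f z.1) 2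
      ((Measure.pi P).prod (Measure.pi P)) := hf.comp_measurePreserving measurePreserving_fst
  have h2 : MemLp (fun z : (Fin p → ℝ) × (Fin p → ℝ) => f (u.piecewise z.1 z.2)) 2
      ((Measure.pi P).prod (Measure.pi P)) :=
    hf.comp_measurePreserving (measurePreserving_piecewise P u)
  have h1m : ∫ z : (Fin p → ℝ) × (Fin p → ℝ), f z.1 ∂((Measure.pi P).prod (Measure.pi P)) = m :=
    integral_comp_hasLaw measurePreserving_fst.hasLaw hf.1
  have h2m : ∫ z : (Fin p → ℝ) × (Fin p → ℝ), f (u.piecewise z.1 z.2)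
      ∂((Measure.pi P).prod (Measure.pi P)) = m :=
    integral_comp_hasLaw (measurePreserving_piecewise P u).hasLaw hf.1
  have h := covariance_eq_sub h1 h2
  rw [covariance, h1m, h2m] at h
  rw [h, sq]
  rfl

/-- Coverage of the pick-freeze interval for the closed index computed on metamodels. -/
theorem tendsto_closedEstimator_coverage (hf : Measurable f)
    (hf4 : Integrable (fun x => f x ^ 4) (Measure.pi P)) (hvar : 0 < variance f (Measure.pi P))
    {ft : ℕ → (Fin p → ℝ) → ℝ} (hft : ∀ n, Measurable (ft n))
    (hL2 : ∃ c : ℝ,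
      Tendsto (fun n => eLpNorm (fun x => ft n x - f x - c) 2 (Measure.pi P)) atTop (𝓝 0))
    (hnVar : Tendsto (fun n : ℕ => (n : ℝ) * variance (fun x => ft n x - f x) (Measure.pi P))
      atTop (𝓝 0))
    {Ω : Type*} [MeasurableSpace Ω] {Pr : Measure Ω} [IsProbabilityMeasure Pr]
    {X : Fin 2 → ℕ → Fin p → Ω → ℝ} (hX : ∀ k j i, Measurable (X k j i))
    (hlaw : ∀ k j i, Pr.map (X k j i) = P i)
    (hindep : iIndepFun (fun a : Fin 2 × ℕ × Fin p => X a.1 a.2.1 a.2.2) Pr)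
    {α : ℝ} (hα : α ∈ Set.Ioo (0 : ℝ) 1) {u : Finset (Fin p)} (hu : asympStd P f u ≠ 0)
    {v : ℕ → Ω → ℝ} (hv : IsConsistent Pr v (asympStd P f u)) :
    Tendsto (fun n => Pr.real {ω | |closedEstimator (ft n) u n
        (fun j i => X 0 j i ω) (fun j i => X 1 j i ω) - closedIndex P f u| ≤
      quantile (gaussianReal 0 1) (1 - α / 2) * (v n ω / √(n : ℝ))}) atTop (𝓝 (1 - α)) := by
  obtain ⟨c, hc⟩ := hL2
  obtain ⟨hz, hq⟩ := quantile_gaussian_coverage hα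
  have hev := eventually_memLp_sub hf hft hc
  have hf2 : MemLp f 2 (Measure.pi P) := memLp_two_of_integrable_pow_four hf hf4
  set m := ∫ x, f x ∂(Measure.pi P) with hm
  set σ := variance f (Measure.pi P) with hσ
  set r : ℕ → (Fin p → ℝ) → ℝ := fun n => discrepancy P f (ft n)
  have hrm : ∀ n, Measurable (r n) := fun n => measurable_discrepancy hf (hft n)
  have hr : ∀ n, MemLp (r n) 2 (Measure.pi P) := fun n => memLp_discrepancy (ft n)
  have hr0 : Tendsto (fun n : ℕ => (n : ℝ) * ∫ x, r n x ^ 2 ∂(Measure.pi P)) atTop (𝓝 0) := by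
    refine hnVar.congr' ?_
    filter_upwards [hev] with n hn
    rw [integral_discrepancy_sq hn]
  have hfst : MeasurePreserving (Prod.fst : (Fin p → ℝ) × (Fin p → ℝ) → Fin p → ℝ)
    ((Measure.pi P).prod (Measure.pi P)) (Measure.pi P) := measurePreserving_fst
  have hpw := measurePreserving_piecewise P u
  have hfc : Measurable fun x => f x - m := hf.sub_const m
  have hfc4 := integrable_sub_const_pow_four hf hf4 m
  have hfc0 : ∫ x, (f x - m) ∂(Measure.pi P) = 0 := by
    rw [integral_sub (hf2.integrable one_le_two) (integrable_const m)]; simp [hm]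
  have hfc2 : ∫ x, (f x - m) ^ 2 ∂(Measure.pi P) = σ :=
    (variance_eq_integral hf.aemeasurable).symm
  have key := tendsto_pickFreeze_coverage (Pr := Pr) (hasLaw_samplePair hX hlaw hindep)
    (iIndepFun_samplePair hX hindep)
    (a := fun z => f z.1 - m) (b := fun z => f (u.piecewise z.1 z.2) - m)
    (hfc.comp hfst.measurable) (hfc.comp hpw.measurable)
    (hfst.integrable_comp_of_integrable hfc4) (hpw.integrable_comp_of_integrable hfc4)
    ((integral_comp_hasLaw hfst.hasLaw hfc.aestronglyMeasurable).trans hfc0)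
    ((integral_comp_hasLaw hpw.hasLaw hfc.aestronglyMeasurable).trans hfc0)
    hvar
    ((integral_comp_hasLaw hfst.hasLaw (hfc.pow_const 2).aestronglyMeasurable).trans hfc2)
    ((integral_comp_hasLaw hpw.hasLaw (hfc.pow_const 2).aestronglyMeasurable).trans hfc2)
    (integral_centred_mul_piecewise hf hf2 hvar.ne' u)
    (s := asympStd P f u) (lt_of_le_of_ne (Real.sqrt_nonneg _) hu.symm)
    (by
      have h0 : 0 ≤ asympVar P f u := div_nonneg (variance_nonneg _ _) (sq_nonneg _)
      rw [mul_pow, asympStd, Real.sq_sqrt h0, asympVar, div_mul_cancel₀ _ (pow_ne_zero 2 hvar.ne')]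
      congr 1
      ext z
      ring)
    (g := fun n z => r n z.1) (h := fun n z => r n (u.piecewise z.1 z.2))
    (fun n => (hrm n).comp hfst.measurable) (fun n => (hrm n).comp hpw.measurable)
    (fun n => (hr n).comp_measurePreserving hfst) (fun n => (hr n).comp_measurePreserving hpw)
    (hr0.congr fun n => congrArg _
      (integral_comp_hasLaw hfst.hasLaw ((hrm n).pow_const 2).aestronglyMeasurable).symm)
    (hr0.congr fun n => congrArg _
      (integral_comp_hasLaw hpw.hasLaw ((hrm n).pow_const 2).aestronglyMeasurable).symm)
    hv hz
  rw [hq] at key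
  refine key.congr' ?_
  filter_upwards [hev, eventually_ne_atTop 0] with n hn hn0
  -- Centred output, centred error, and a constant that the ratio does not see.
  have hft_eq : ∀ x, ft n x = f x - m + r n x + (m + ∫ y, ft n y - f y ∂(Measure.pi P)) := by
    intro x
    simp only [r, discrepancy, if_pos hn]
    ring
  have hest : ∀ x₁ x₂ : ℕ → Fin p → ℝ, closedEstimator (ft n) u n x₁ x₂ =
      pickFreeze n (fun j => f (x₁ j) - m + r n (x₁ j))
        (fun j => f (u.piecewise (x₁ j) (x₂ j)) - m + r n (u.piecewise (x₁ j) (x₂ j))) := by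
    intro x₁ x₂
    exact (congrArg₂ (pickFreeze n) (funext fun j => hft_eq _) (funext fun j => hft_eq _)).trans
      (pickFreeze_add_const hn0 _ _ _)
  simp only [hest]

end Metamodel

end

end Sobol

/-! ### The two asymptotic confidence intervals -/

theorem corollary1 {p : ℕ}
    -- laws of the independent inputs
    (P : Fin p → Measure ℝ) [∀ i, IsProbabilityMeasure (P i)]
    -- the model
    (f : (Fin p → ℝ) → ℝ) (hf : Measurable f)
    (hf4 : Integrable (fun x => f x ^ 4) (Measure.pi P))
    (hvar : 0 < variance f (Measure.pi P))
    -- the metamodels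
    (ft : ℕ → (Fin p → ℝ) → ℝ) (hft : ∀ n, Measurable (ft n))
    (hL2 : ∃ c : ℝ,
      Tendsto (fun n => eLpNorm (fun x => ft n x - f x - c) 2 (Measure.pi P)) atTop (𝓝 0))
    (hnVar : Tendsto (fun n : ℕ => (n : ℝ) * variance (fun x => ft n x - f x) (Measure.pi P))
      atTop (𝓝 0))
    -- the two independent i.i.d. samples of the inputs
    {Ω : Type*} [MeasurableSpace Ω] (Pr : Measure Ω) [IsProbabilityMeasure Pr]
    (X : Fin 2 → ℕ → Fin p → Ω → ℝ) (hX : ∀ k j i, Measurable (X k j i))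
    (hlaw : ∀ k j i, Pr.map (X k j i) = P i)
    (hindep : iIndepFun (fun a : Fin 2 × ℕ × Fin p => X a.1 a.2.1 a.2.2) Pr)
    (α : ℝ) (hα : α ∈ Set.Ioo (0 : ℝ) 1) :
    (∀ u : Finset (Fin p), Sobol.asympStd P f u ≠ 0 →
      ∀ v : ℕ → Ω → ℝ, Sobol.IsConsistent Pr v (Sobol.asympStd P f u) →
        Sobol.IsAsymptoticCI Pr (Sobol.closedIndex P f u)
          (fun n ω => Sobol.closedEstimator (ft n) u n
              (fun j i => X 0 j i ω) (fun j i => X 1 j i ω)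
            - Sobol.quantile (gaussianReal 0 1) (1 - α / 2) * (v n ω / Real.sqrt n))
          (fun n ω => Sobol.closedEstimator (ft n) u n
              (fun j i => X 0 j i ω) (fun j i => X 1 j i ω)
            + Sobol.quantile (gaussianReal 0 1) (1 - α / 2) * (v n ω / Real.sqrt n))
          (1 - α)) ∧
    (∀ i₀ : Fin p, Sobol.asympStd P f ({i₀}ᶜ) ≠ 0 →
      ∀ v : ℕ → Ω → ℝ, Sobol.IsConsistent Pr v (Sobol.asympStd P f ({i₀}ᶜ)) →
        Sobol.IsAsymptoticCI Pr (Sobol.totalIndex P f i₀)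
          (fun n ω => Sobol.totalEstimator (ft n) i₀ n
              (fun j i => X 0 j i ω) (fun j i => X 1 j i ω)
            - Sobol.quantile (gaussianReal 0 1) (1 - α / 2) * (v n ω / Real.sqrt n))
          (fun n ω => Sobol.totalEstimator (ft n) i₀ n
              (fun j i => X 0 j i ω) (fun j i => X 1 j i ω)
            + Sobol.quantile (gaussianReal 0 1) (1 - α / 2) * (v n ω / Real.sqrt n))
          (1 - α)) := by
  have hf2 : MemLp f 2 (Measure.pi P) := Sobol.memLp_two_of_integrable_pow_four hf hf4
  refine ⟨fun u hu v hv => ?_, fun i₀ hi v hv => ?_⟩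
  · refine (Sobol.tendsto_closedEstimator_coverage hf hf4 hvar hft hL2 hnVar hX hlaw hindep hα
      hu hv).congr fun n => congrArg Pr.real (Set.ext fun ω => ?_)
    simp only [Set.mem_ofPred_eq, Set.mem_Icc, abs_le]
    constructor <;> rintro ⟨h1, h2⟩ <;> constructor <;> linarith
  · refine (Sobol.tendsto_closedEstimator_coverage hf hf4 hvar hft hL2 hnVar hX hlaw hindep hα
      hi hv).congr fun n => congrArg Pr.real (Set.ext fun ω => ?_)
    -- Index and estimator are both one minus their closed counterparts along the complement, so the
    -- deviation only changes sign and the symmetric interval covers on the same event.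
    rw [Sobol.totalIndex_eq P hf hf2 hvar.ne']
    simp only [Set.mem_ofPred_eq, Set.mem_Icc, abs_le, Sobol.totalEstimator]
    constructor <;> rintro ⟨h1, h2⟩ <;> constructor <;> linarith
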